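/- Let $\Omega\subset\mathbb{R}^d$ be a compact convex set with non-empty interior $\Omega^\circ$. Let $X_0,X_1$ be independent random vectors with Lebesgue densities $p_0,p_1$ that vanish outside $\Omega$ and whose restrictions to $\Omega$ are continuous and bounded away from zero. For $t\in[0,1]$ define $$v(t,z)=\frac{\int_{\mathbb{R}^d}\delta\,p_0(z-t\delta)\,p_1(z+(1-t)\delta)\,d\delta}{\int_{\mathbb{R}^d}p_0(z-t\delta)\,p_1(z+(1-t)\delta)\,d\delta}$$ (with the value $0$ where the denominator vanishes; this can only happen for $z\notin\Omega^\circ$), and, for $\eta\ge 0$, $$\omega(\eta)=\sup_{z,z'\in\Omega,\ \|z-z'\|\le\eta}\max\left\{\left|\frac{p_0(z)}{p_0(z')}-1\right|,\ \left|\frac{p_1(z)}{p_1(z')}-1\right|\right\}.$$ Assume that $\eta\mapsto\omega(\eta)+\eta$ is a non-decreasing Osgood function, that is, $\int_\varepsilon^1\frac{du}{u+\omega(u)}\to\infty$ as $\varepsilon\downarrow0$. Then for every $t\in[0,1]$ the function $v(t,\cdot)$ is continuous on $\Omega^\circ$ and $v(t,(1-t)X_0+tX_1)=\mathbb{E}[X_1-X_0\mid(1-t)X_0+tX_1]$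 almost surely. Moreover, for every $x\in\Omega^\circ$ there is exactly one function $z:[0,1]\to\mathbb{R}^d$ such that $s\mapsto v(s,z(s))$ is integrable on $[0,1]$ and $$z(t)=x+\int_0^t v(s,z(s))\,ds\qquad\text{for all }t\in[0,1]$$ (a Carathéodory solution of $z'(t)=v(t,z(t))$, $z(0)=x$). This solution satisfies $z(t)\in\Omega^\circ$ for all $t\in[0,1)$ and $z(1)\in\Omega$. -/

import Mathlib

open MeasureTheory ProbabilityTheory Set Filter Topology

noncomputable section

namespace RectifiedFlow

/-- `p` is a function that is continuous and bounded away from zero on `Ω`,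
and vanishes off `Ω`. -/
structure IsRegularDensityOn {d : ℕ} (Ω : Set (EuclideanSpace ℝ (Fin d)))
    (p : EuclideanSpace ℝ (Fin d) → ℝ) : Prop where
  continuousOn : ContinuousOn p Ω
  bounded_away : ∃ c : ℝ, 0 < c ∧ ∀ x ∈ Ω, c ≤ p x
  eq_zero_off : ∀ x, x ∉ Ω → p x = 0

/-- `p_t(z) = ∫ p₀(z - tδ) p₁(z + (1-t)δ) dδ`. -/
def interpDensity {d : ℕ} (p₀ p₁ : EuclideanSpace ℝ (Fin d) → ℝ)
    (t : ℝ) (z : EuclideanSpace ℝ (Fin d)) : ℝ :=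
  ∫ δ, p₀ (z - t • δ) * p₁ (z + (1 - t) • δ)

/-- `f_t(z) = ∫ δ p₀(z - tδ) p₁(z + (1-t)δ) dδ`. -/
def interpFlux {d : ℕ} (p₀ p₁ : EuclideanSpace ℝ (Fin d) → ℝ)
    (t : ℝ) (z : EuclideanSpace ℝ (Fin d)) : EuclideanSpace ℝ (Fin d) :=
  ∫ δ, (p₀ (z - t • δ) * p₁ (z + (1 - t) • δ)) • δ

/-- The velocity field `v(t, z) = f_t(z) / p_t(z)` of the independent coupling: the pointwise
formula for `E[X₁ - X₀ | (1-t) X₀ + t X₁ = z]`. -/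
def velocity {d : ℕ} (p₀ p₁ : EuclideanSpace ℝ (Fin d) → ℝ)
    (t : ℝ) (z : EuclideanSpace ℝ (Fin d)) : EuclideanSpace ℝ (Fin d) :=
  (interpDensity p₀ p₁ t z)⁻¹ • interpFlux p₀ p₁ t z

/-- The joint relative modulus of continuity `ω(η)` of `p₀` and `p₁` on `Ω`. -/
def densityModulus {d : ℕ} (Ω : Set (EuclideanSpace ℝ (Fin d)))
    (p₀ p₁ : EuclideanSpace ℝ (Fin d) → ℝ) (η : ℝ) : ℝ :=
  sSup {r : ℝ | ∃ z ∈ Ω, ∃ z' ∈ Ω, ‖z - z'‖ ≤ η ∧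
    r = max |p₀ z / p₀ z' - 1| |p₁ z / p₁ z' - 1|}

/-- `κ` is a non-decreasing Osgood function: `κ(0) = 0`, and the primitive
`Ψ(ε) = ∫_1^ε du / κ(u)` tends to `-∞` as `ε ↓ 0`. -/
structure IsOsgood (κ : ℝ → ℝ) : Prop where
  monotoneOn : MonotoneOn κ (Ici 0)
  map_zero : κ 0 = 0
  tendsto_primitive : Tendsto (fun ε : ℝ => ∫ u in (1 : ℝ)..ε, 1 / κ u) (𝓝[>] 0) atBot

/-- `z` (read on `[0, 1]`) is a Carathéodory solution of `z' = v(t, z)`, `z(0) = x`: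
`s ↦ v(s, z(s))` is integrable and `z(t) = x + ∫_0^t v(s, z(s)) ds` for all `t ∈ [0, 1]`. -/
structure IsCaratheodorySolution {d : ℕ}
    (v : ℝ → EuclideanSpace ℝ (Fin d) → EuclideanSpace ℝ (Fin d))
    (x : EuclideanSpace ℝ (Fin d)) (z : ℝ → EuclideanSpace ℝ (Fin d)) : Prop where
  intervalIntegrable : IntervalIntegrable (fun s => v s (z s)) volume 0 1
  integral_eq : ∀ t ∈ Icc (0 : ℝ) 1, z t = x + ∫ s in (0 : ℝ)..t, v s (z s)

end RectifiedFlow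

end

/-!
Write `k_t(z, δ) = p₀(z - tδ) p₁(z + (1-t)δ)` for the joint density of the interpolant and the
displacement. The vector `z + (1-t) v(t, z)` is the `k_t(z, ·)`-weighted average of the endpoints
`z + (1-t)δ ∈ Ω`, so it lies in `Ω` by convexity; for a solution, `((1-t)⁻¹ z)' = (1-t)⁻² (z +
(1-t) v)` then exhibits `z(τ)` as `(1-τ) z(0) + τ w` with `w ∈ Ω`, which is interior for `τ < 1`.
Since `v` is bounded and continuous on the interior, Peano's theorem gives a solution.

For uniqueness, `k_t(z, ·)` and `k_t(z', ·)` differ by `O(ω(‖z - z'‖))` where both are supported,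
and their supports, `{δ | z - tδ ∈ Ω, z + (1-t)δ ∈ Ω}`, differ by a set of measure `O(‖z - z'‖)`
because they are convex bodies containing a fixed ball. Hence `v(t, ·)` has the modulus
`C (ω(η) + η)` locally in the interior and Osgood's criterion applies.
-/

namespace RectifiedFlow

section WeightedAverage

variable {E : Type*} [NormedAddCommGroup E] [NormedSpace ℝ E]

theorem continuousOn_inv_one_sub_sq {τ : ℝ} (hτ : τ < 1) :
    ContinuousOn (fun t : ℝ => ((1 - t) ^ 2)⁻¹) (Icc 0 τ) :=
  ((continuousOn_const.sub continuousOn_id).pow 2).inv₀ fun _ ht =>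
    pow_ne_zero 2 (sub_pos.2 (ht.2.trans_lt hτ)).ne'

theorem intervalIntegrable_inv_one_sub_sq_smul {τ : ℝ} (hτ₀ : 0 ≤ τ) (hτ₁ : τ < 1) {z v : ℝ → E}
    (hz : ContinuousOn z (Icc 0 τ)) (hv : IntervalIntegrable v volume 0 τ) :
    IntervalIntegrable (fun t => ((1 - t) ^ 2)⁻¹ • (z t + (1 - t) • v t)) volume 0 τ :=
  ((hz.intervalIntegrable_of_Icc hτ₀).add
    (hv.continuousOn_smul (by fun_prop))).continuousOn_smul
      (by simpa only [uIcc_of_le hτ₀] using continuousOn_inv_one_sub_sq hτ₁)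

variable [CompleteSpace E]

theorem integral_inv_one_sub_sq_smul {τ : ℝ} (hτ₀ : 0 ≤ τ) (hτ₁ : τ < 1) {z v : ℝ → E}
    (hz : ContinuousOn z (Icc 0 τ)) (hderiv : ∀ t ∈ Ioo 0 τ, HasDerivAt z (v t) t)
    (hv : IntervalIntegrable v volume 0 τ) :
    ∫ t in (0 : ℝ)..τ, ((1 - t) ^ 2)⁻¹ • (z t + (1 - t) • v t) = (1 - τ)⁻¹ • z τ - z 0 := by
  have hne : ∀ t ∈ Icc 0 τ, 1 - t ≠ 0 := fun t ht => (sub_pos.2 (ht.2.trans_lt hτ₁)).ne'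
  have hcont : ContinuousOn (fun t => (1 - t)⁻¹ • z t) (Icc 0 τ) :=
    ((continuousOn_const.sub continuousOn_id).inv₀ hne).smul hz
  have hderiv' : ∀ t ∈ Ioo 0 τ, HasDerivAt (fun t => (1 - t)⁻¹ • z t)
      (((1 - t) ^ 2)⁻¹ • (z t + (1 - t) • v t)) t := fun t ht => by
    have hnet := hne t (Ioo_subset_Icc_self ht)
    refine ((((hasDerivAt_id t).const_sub 1).fun_inv hnet).fun_smul
      (hderiv t ht)).congr_deriv ?_
    simp only [id, neg_neg]
    match_scalars <;> field_simp
  rw [intervalIntegral.integral_eq_sub_of_hasDerivAt_of_le hτ₀ hcont hderiv'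
    (intervalIntegrable_inv_one_sub_sq_smul hτ₀ hτ₁ hz hv)]
  simp only [sub_zero, inv_one, one_smul]

theorem integral_inv_one_sub_sq {τ : ℝ} (hτ₀ : 0 ≤ τ) (hτ₁ : τ < 1) :
    ∫ t in (0 : ℝ)..τ, ((1 - t) ^ 2)⁻¹ = τ / (1 - τ) := by
  have h := integral_inv_one_sub_sq_smul hτ₀ hτ₁ (z := fun _ => (1 : ℝ)) (v := fun _ => 0)
    continuousOn_const (fun t _ => hasDerivAt_const t 1) intervalIntegrable_const
  simp only [smul_eq_mul, mul_zero, add_zero, mul_one] at h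
  rw [h, eq_div_iff (sub_pos.2 hτ₁).ne', sub_mul, inv_mul_cancel₀ (sub_pos.2 hτ₁).ne']
  ring

variable {s : Set E}

theorem inv_integral_smul_integral_smul_mem {α : Type*} [MeasurableSpace α] {μ : Measure α}
    (hs : Convex ℝ s) (hsc : IsClosed s) {k : α → ℝ} {f : α → E} (hk : 0 ≤ k)
    (hki : Integrable k μ) (hpos : 0 < ∫ a, k a ∂μ) (hf : ∀ᵐ a ∂μ, k a ≠ 0 → f a ∈ s)
    (hfi : Integrable (fun a => k a • f a) μ) :
    (∫ a, k a ∂μ)⁻¹ • ∫ a, k a • f a ∂μ ∈ s := by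
  have hm : AEMeasurable (fun a => ENNReal.ofReal (k a)) μ := hki.aemeasurable.ennreal_ofReal
  have htop : ∀ᵐ a ∂μ, ENNReal.ofReal (k a) < ⊤ := .of_forall fun _ => ENNReal.ofReal_lt_top
  have htoReal : ∀ a, (ENNReal.ofReal (k a)).toReal = k a := fun a => ENNReal.toReal_ofReal (hk a)
  set ν := μ.withDensity fun a => ENNReal.ofReal (k a) with hν
  have hmass : ν univ = ENNReal.ofReal (∫ a, k a ∂μ) := by
    rw [hν, withDensity_apply _ MeasurableSet.univ, Measure.restrict_univ,
      ofReal_integral_eq_lintegral_ofReal hki (.of_forall hk)]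
  have : IsFiniteMeasure ν := ⟨by rw [hmass]; exact ENNReal.ofReal_lt_top⟩
  have : NeZero ν := ⟨fun h => by simp [h, hpos.not_ge] at hmass⟩
  have hfν : ∀ᵐ a ∂ν, f a ∈ s := by
    rw [ae_withDensity_iff' hm]
    filter_upwards [hf] with a ha hka
    exact ha fun h => hka (by rw [h, ENNReal.ofReal_zero])
  have hfiν : Integrable f ν := by
    rw [integrable_withDensity_iff_integrable_smul₀' hm htop]
    simpa only [htoReal] using hfi
  have hmean : ⨍ a, f a ∂ν ∈ s := hs.average_mem hsc hfν hfiν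
  rw [average_eq, measureReal_def, hmass, ENNReal.toReal_ofReal hpos.le,
    integral_withDensity_eq_integral_toReal_smul₀ hm htop] at hmean
  simpa only [htoReal] using hmean

/- Since `((1 - t)⁻¹ z)' = (1 - t)⁻² (z + (1 - t) z')`, the vector `(1 - τ)⁻¹ z(τ) - z(0)` is an
integral of points of `s` against the weight `(1 - t)⁻²`, whose total mass is `τ / (1 - τ)`. -/
theorem exists_eq_add_smul_of_hasDerivAt (hs : Convex ℝ s) (hsc : IsClosed s) {τ : ℝ}
    (hτ₀ : 0 < τ) (hτ₁ : τ < 1) {z v : ℝ → E} (hz : ContinuousOn z (Icc 0 τ))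
    (hderiv : ∀ t ∈ Ioo 0 τ, HasDerivAt z (v t) t) (hv : IntervalIntegrable v volume 0 τ)
    (hmem : ∀ t ∈ Ioo 0 τ, z t + (1 - t) • v t ∈ s) :
    ∃ w ∈ s, z τ = (1 - τ) • z 0 + τ • w := by
  have hτ : 0 < 1 - τ := sub_pos.2 hτ₁
  have hmean := inv_integral_smul_integral_smul_mem (μ := volume.restrict (Ioc 0 τ)) hs hsc
    (k := fun t => ((1 - t) ^ 2)⁻¹) (f := fun t => z t + (1 - t) • v t)
    (fun t => inv_nonneg.2 (sq_nonneg (1 - t)))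
    ((continuousOn_inv_one_sub_sq hτ₁).intervalIntegrable_of_Icc hτ₀.le).1
    (by
      rw [← intervalIntegral.integral_of_le hτ₀.le, integral_inv_one_sub_sq hτ₀.le hτ₁]
      exact div_pos hτ₀ hτ)
    (by
      rw [← restrict_Ioo_eq_restrict_Ioc]
      filter_upwards [ae_restrict_mem measurableSet_Ioo] with t ht _ using hmem t ht)
    (intervalIntegrable_inv_one_sub_sq_smul hτ₀.le hτ₁ hz hv).1
  refine ⟨_, hmean, ?_⟩
  rw [← intervalIntegral.integral_of_le hτ₀.le, ← intervalIntegral.integral_of_le hτ₀.le,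
    integral_inv_one_sub_sq hτ₀.le hτ₁, integral_inv_one_sub_sq_smul hτ₀.le hτ₁ hz hderiv hv]
  match_scalars <;> field_simp
  ring

end WeightedAverage

section Osgood

theorem intervalIntegrable_comp_of_monotoneOn {κ : ℝ → ℝ} {c : ℝ} (hκ : MonotoneOn κ (Ici c))
    {a b : ℝ} (hab : a ≤ b) {w : ℝ → ℝ} (hw : ContinuousOn w (Icc a b))
    (hcw : ∀ t ∈ Icc a b, c ≤ w t) :
    IntervalIntegrable (fun s => κ (w s)) volume a b := by
  obtain ⟨m, hm⟩ := (isCompact_Icc.image_of_continuousOn hw).bddAbove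
  have hmono : Monotone fun u => κ (max u c) := fun u v huv =>
    hκ (mem_Ici.2 (le_max_right _ _)) (mem_Ici.2 (le_max_right _ _)) (max_le_max_right c huv)
  have hmeas : AEMeasurable (fun s => κ (max (w s) c)) (volume.restrict (Icc a b)) :=
    hmono.measurable.comp_aemeasurable (hw.aemeasurable measurableSet_Icc)
  have heq : (fun s => κ (max (w s) c)) =ᵐ[volume.restrict (Icc a b)] fun s => κ (w s) := by
    filter_upwards [ae_restrict_mem measurableSet_Icc] with s hs
    rw [max_eq_left (hcw s hs)]
  rw [intervalIntegrable_iff_integrableOn_Icc_of_le hab]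
  refine (integrable_const (max |κ c| |κ m|)).mono' (hmeas.congr heq).aestronglyMeasurable ?_
  filter_upwards [ae_restrict_mem measurableSet_Icc] with s hs
  have hwm : w s ≤ m := hm (mem_image_of_mem w hs)
  exact abs_le_max_abs_abs (hκ self_mem_Ici (hcw s hs) (hcw s hs))
    (hκ (hcw s hs) ((hcw s hs).trans hwm) hwm)

variable {κ : ℝ → ℝ}

theorem IsOsgood.nonneg (hκ : IsOsgood κ) {u : ℝ} (hu : 0 ≤ u) : 0 ≤ κ u :=
  hκ.map_zero.symm.trans_le (hκ.monotoneOn self_mem_Ici hu hu)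

/- If `κ` vanished at `u > 0`, it would vanish on `[0, u]`, and since `1 / 0 = 0` the primitive of
`1 / κ` would be constant near `0`. -/
theorem IsOsgood.pos (hκ : IsOsgood κ) {u : ℝ} (hu : 0 < u) : 0 < κ u := by
  refine (hκ.nonneg hu.le).lt_of_ne' fun hκu => ?_
  have hzero : ∀ v ∈ Icc 0 u, 1 / κ v = 0 := fun v hv => by
    rw [(((hκ.monotoneOn hv.1 hu.le hv.2).trans_eq hκu).antisymm (hκ.nonneg hv.1)), div_zero]
  have hconst : ∀ ε ∈ Ioo 0 u, ∫ v in (1 : ℝ)..ε, 1 / κ v = ∫ v in (1 : ℝ)..u, 1 / κ v := by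
    intro ε hε
    have heq : EqOn (fun v => 1 / κ v) 0 (uIcc u ε) := fun v hv =>
      hzero v (by rw [uIcc_of_ge hε.2.le] at hv; exact ⟨hε.1.le.trans hv.1, hv.2⟩)
    have hint : IntervalIntegrable (fun v => 1 / κ v) volume u ε :=
      IntervalIntegrable.zero.congr fun v hv => (heq (uIoc_subset_uIcc hv)).symm
    by_cases h : IntervalIntegrable (fun v => 1 / κ v) volume 1 u
    · rw [← intervalIntegral.integral_add_adjacent_intervals h hint,
        intervalIntegral.integral_congr heq]
      simp
    · rw [intervalIntegral.integral_undef h,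
        intervalIntegral.integral_undef fun h' => h (h'.trans hint.symm)]
  exact (hκ.tendsto_primitive.congr'
    (eventually_of_mem (Ioo_mem_nhdsGT hu) hconst)).not_tendsto
      (disjoint_nhds_atBot _).symm tendsto_const_nhds

theorem IsOsgood.one_div_antitoneOn (hκ : IsOsgood κ) :
    AntitoneOn (fun u => 1 / κ u) (Ioi 0) := fun _ hu _ hv huv =>
  one_div_le_one_div_of_le (hκ.pos hu) (hκ.monotoneOn (mem_Ici_of_Ioi hu) (mem_Ici_of_Ioi hv) huv)

theorem IsOsgood.intervalIntegrable_one_div (hκ : IsOsgood κ) {a b : ℝ} (ha : 0 < a) (hb : 0 < b) :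
    IntervalIntegrable (fun u => 1 / κ u) volume a b :=
  (hκ.one_div_antitoneOn.mono fun _ hu => (lt_min ha hb).trans_le hu.1).intervalIntegrable

theorem IsOsgood.integral_one_div_le (hκ : IsOsgood κ) {a b : ℝ} (ha : 0 < a) (hab : a ≤ b) :
    ∫ u in a..b, 1 / κ u ≤ (b - a) / κ a := by
  have h := intervalIntegral.integral_mono_on hab
    (hκ.intervalIntegrable_one_div ha (ha.trans_le hab))
    (intervalIntegrable_const (c := 1 / κ a))
    fun u hu => hκ.one_div_antitoneOn ha (ha.trans_le hu.1) hu.1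
  rwa [intervalIntegral.integral_const, smul_eq_mul, mul_one_div] at h

theorem IsOsgood.tendsto_integral_one_div (hκ : IsOsgood κ) {b : ℝ} (hb : 0 < b) :
    Tendsto (fun ε => ∫ u in ε..b, 1 / κ u) (𝓝[>] 0) atTop := by
  refine (tendsto_atTop_add_const_right _ (∫ u in (1 : ℝ)..b, 1 / κ u)
    (tendsto_neg_atBot_atTop.comp hκ.tendsto_primitive)).congr' ?_
  filter_upwards [self_mem_nhdsWithin] with ε hε
  rw [Function.comp_apply, ← intervalIntegral.integral_symm]
  exact intervalIntegral.integral_add_adjacent_intervals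
    (hκ.intervalIntegrable_one_div hε one_pos) (hκ.intervalIntegrable_one_div one_pos hb)

variable {a b C : ℝ}

/- Going backwards in time, halving the value of `W` from `c` to `c / 2` takes at least
`c / (2 C κ(c))`, and `c / κ(c)` dominates the integral of `1 / κ` over `[c, 2c]`. -/
theorem IsOsgood.exists_integral_one_div_le (hκ : IsOsgood κ) {W : ℝ → ℝ} (hab : a ≤ b)
    (hW : ContinuousOn W (Icc a b)) (hWa : W a ≤ 0) (hWb : 0 < W b)
    (hstep : ∀ s ∈ Icc a b, ∀ t ∈ Icc s b, 0 < W t → W t - W s ≤ C * κ (W t) * (t - s)) (N : ℕ) :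
    ∃ t ∈ Icc a b, W t = W b / 2 ^ N ∧
      ∫ u in (2 * (W b / 2 ^ N))..(2 * W b), 1 / κ u ≤ 2 * C * (b - t) := by
  induction N with
  | zero => exact ⟨b, right_mem_Icc.2 hab, by simp, by simp⟩
  | succ N ih =>
    obtain ⟨t, ht, hWt, hI⟩ := ih
    set c := W b / 2 ^ N with hc
    have hc0 : 0 < c := by positivity
    have hhalf : W b / 2 ^ (N + 1) = c / 2 := by rw [hc, pow_succ, div_div]
    obtain ⟨s, hs, hWs⟩ : c / 2 ∈ W '' Icc a t :=
      intermediate_value_Icc ht.1 (hW.mono (Icc_subset_Icc_right ht.2))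
        ⟨by linarith, by linarith⟩
    have htime : c / κ c ≤ 2 * C * (t - s) := by
      have h := hstep s ⟨hs.1, hs.2.trans ht.2⟩ t ⟨hs.2, ht.2⟩ (by rwa [hWt])
      rw [hWt, hWs] at h
      rw [div_le_iff₀ (hκ.pos hc0)]
      linarith
    have hdyadic : ∫ u in c..(2 * c), 1 / κ u ≤ c / κ c := by
      have h := hκ.integral_one_div_le hc0 (by linarith : c ≤ 2 * c)
      rwa [two_mul, add_sub_cancel_right, ← two_mul] at h
    refine ⟨s, ⟨hs.1, hs.2.trans ht.2⟩, hWs.trans hhalf.symm, ?_⟩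
    rw [hhalf, mul_div_cancel₀ c two_ne_zero, ← intervalIntegral.integral_add_adjacent_intervals
      (hκ.intervalIntegrable_one_div hc0 (by positivity : 0 < 2 * c))
      (hκ.intervalIntegrable_one_div (by positivity) (by positivity))]
    linarith

theorem IsOsgood.nonpos_of_sub_le (hκ : IsOsgood κ) {W : ℝ → ℝ} (hab : a ≤ b) (hC : 0 ≤ C)
    (hW : ContinuousOn W (Icc a b)) (hWa : W a ≤ 0)
    (hstep : ∀ s ∈ Icc a b, ∀ t ∈ Icc s b, 0 < W t → W t - W s ≤ C * κ (W t) * (t - s)) :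
    W b ≤ 0 := by
  by_contra! hWb
  have hdyadic : Tendsto (fun N : ℕ => 2 * (W b / 2 ^ N)) atTop (𝓝[>] 0) := by
    refine tendsto_nhdsWithin_iff.2 ⟨?_, .of_forall fun N => by rw [mem_Ioi]; positivity⟩
    simpa only [mul_zero] using (tendsto_const_nhds.div_atTop
      (tendsto_pow_atTop_atTop_of_one_lt one_lt_two)).const_mul (2 : ℝ)
  obtain ⟨N, hN⟩ := (((hκ.tendsto_integral_one_div (mul_pos two_pos hWb)).comp
    hdyadic).eventually_gt_atTop (2 * C * (b - a))).exists
  obtain ⟨t, ht, -, hle⟩ := hκ.exists_integral_one_div_le hab hW hWa hWb hstep N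
  have : 2 * C * (b - t) ≤ 2 * C * (b - a) :=
    mul_le_mul_of_nonneg_left (by linarith [ht.1]) (by positivity)
  exact (hN.trans_le (hle.trans this)).false

theorem IsOsgood.eqOn_zero_of_le_integral (hκ : IsOsgood κ) (hC : 0 ≤ C) {w : ℝ → ℝ}
    (hw : ContinuousOn w (Icc a b)) (hw0 : ∀ t ∈ Icc a b, 0 ≤ w t)
    (hle : ∀ t ∈ Icc a b, w t ≤ ∫ s in a..t, C * κ (w s)) :
    EqOn w 0 (Icc a b) := by
  intro t₁ ht₁
  have ha : a ∈ Icc a b := left_mem_Icc.2 (ht₁.1.trans ht₁.2)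
  have hint : ∀ s ∈ Icc a b, ∀ t ∈ Icc s b, IntervalIntegrable (fun s => C * κ (w s)) volume s t :=
    fun s hs t ht => (intervalIntegrable_comp_of_monotoneOn hκ.monotoneOn ht.1
      (hw.mono (Icc_subset_Icc hs.1 ht.2))
      fun u hu => hw0 u ⟨hs.1.trans hu.1, hu.2.trans ht.2⟩).const_mul C
  set W : ℝ → ℝ := fun t => ∫ s in a..t, C * κ (w s)
  have hsub : ∀ s ∈ Icc a b, ∀ t ∈ Icc s b, W t - W s = ∫ u in s..t, C * κ (w u) :=
    fun s hs t ht => intervalIntegral.integral_interval_sub_left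
      (hint a ha t ⟨hs.1.trans ht.1, ht.2⟩) (hint a ha s hs)
  have hmono : ∀ s ∈ Icc a b, ∀ t ∈ Icc s b, W s ≤ W t := fun s hs t ht => by
    rw [← sub_nonneg, hsub s hs t ht]
    exact intervalIntegral.integral_nonneg ht.1 fun u hu =>
      mul_nonneg hC (hκ.nonneg (hw0 u ⟨hs.1.trans hu.1, hu.2.trans ht.2⟩))
  have hstep : ∀ s ∈ Icc a b, ∀ t ∈ Icc s b, W t - W s ≤ C * κ (W t) * (t - s) := by
    intro s hs t ht
    rw [hsub s hs t ht]
    refine (intervalIntegral.integral_mono_on ht.1 (hint s hs t ht)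
      (intervalIntegrable_const (c := C * κ (W t))) fun u hu => ?_).trans_eq ?_
    · have hu' : u ∈ Icc a b := ⟨hs.1.trans hu.1, hu.2.trans ht.2⟩
      have hwW : w u ≤ W t := (hle u hu').trans (hmono u hu' t ⟨hu.2, ht.2⟩)
      exact mul_le_mul_of_nonneg_left
        (hκ.monotoneOn (hw0 u hu') ((hw0 u hu').trans hwW) hwW) hC
    · rw [intervalIntegral.integral_const, smul_eq_mul, mul_comm]
  have hWc : ContinuousOn W (Icc a t₁) := by
    rw [← uIcc_of_le ht₁.1]
    exact intervalIntegral.continuousOn_primitive_interval' (hint a ha t₁ ht₁) left_mem_uIcc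
  have hWt₁ : W t₁ ≤ 0 := hκ.nonpos_of_sub_le ht₁.1 hC hWc intervalIntegral.integral_same.le
    fun s hs t ht _ => hstep s ⟨hs.1, hs.2.trans ht₁.2⟩ t ⟨ht.1, ht.2.trans ht₁.2⟩
  exact le_antisymm ((hle t₁ ht₁).trans hWt₁) (hw0 t₁ ht₁)

end Osgood

section Peano

variable {E : Type*} [NormedAddCommGroup E] [NormedSpace ℝ E] {F : ℝ → E → E} {D : NNReal}
  {h T : ℝ} {x : E} {y y' : ℝ → E}

/-- The Picard operator of `y' = F(t, y)`, `y(0) = x` with a time delay `h` on the right-hand side.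
Its values at negative times are frozen to `x`, so that it acts on curves defined on all of `ℝ`. -/
noncomputable def delayedPicard (F : ℝ → E → E) (h : ℝ) (x : E) (y : ℝ → E) (t : ℝ) : E :=
  x + ∫ s in (0 : ℝ)..max t 0, F s (y (s - h))

theorem delayedPicard_of_nonneg {t : ℝ} (ht : 0 ≤ t) :
    delayedPicard F h x y t = x + ∫ s in (0 : ℝ)..t, F s (y (s - h)) := by
  rw [delayedPicard, max_eq_left ht]

theorem delayedPicard_of_nonpos {t : ℝ} (ht : t ≤ 0) : delayedPicard F h x y t = x := by
  rw [delayedPicard, max_eq_right ht, intervalIntegral.integral_same, add_zero]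

theorem eqOn_delayedPicard {r : ℝ} (hyy' : EqOn y y' (Iic r)) :
    EqOn (delayedPicard F h x y) (delayedPicard F h x y') (Iic (r + h)) := by
  intro t ht
  rcases le_total t 0 with ht0 | ht0
  · rw [delayedPicard_of_nonpos ht0, delayedPicard_of_nonpos ht0]
  · rw [delayedPicard_of_nonneg ht0, delayedPicard_of_nonneg ht0]
    refine congrArg (x + ·) (intervalIntegral.integral_congr fun s hs => ?_)
    rw [uIcc_of_le ht0] at hs
    exact congrArg (F s) (hyy' (sub_le_iff_le_add.2 (hs.2.trans ht)))

theorem eqOn_delayedPicard_iterate (k : ℕ) :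
    EqOn (delayedPicard F h x ((delayedPicard F h x)^[k] fun _ => x))
      ((delayedPicard F h x)^[k] fun _ => x) (Iic (k * h)) := by
  induction k with
  | zero => exact fun t ht => delayedPicard_of_nonpos (by simpa using ht)
  | succ k ih =>
    rw [Function.iterate_succ_apply', Nat.cast_succ, add_one_mul]
    exact eqOn_delayedPicard ih

variable [MeasurableSpace E] [BorelSpace E] [SecondCountableTopology E]

theorem lipschitzWith_delayedPicard (hF : Measurable (Function.uncurry F))
    (hD : ∀ t x, ‖F t x‖ ≤ D) (hy : Measurable y) : LipschitzWith D (delayedPicard F h x y) := by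
  have hmeas : Measurable fun s => F s (y (s - h)) :=
    hF.comp (measurable_id.prodMk (hy.comp (measurable_id.sub_const h)))
  have hint : ∀ s t, IntervalIntegrable (fun s => F s (y (s - h))) volume s t := fun s t =>
    (intervalIntegrable_const (c := (D : ℝ))).mono_fun hmeas.aestronglyMeasurable
      (.of_forall fun u => (hD _ _).trans (le_abs_self _))
  refine LipschitzWith.of_dist_le_mul fun s t => ?_
  rw [dist_eq_norm, delayedPicard, delayedPicard, add_sub_add_left_eq_sub,
    intervalIntegral.integral_interval_sub_left (hint _ _) (hint _ _)]
  exact (intervalIntegral.norm_integral_le_of_norm_le_const fun u _ => hD _ _).trans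
    (mul_le_mul_of_nonneg_left (abs_max_sub_max_le_abs s t 0) D.2)

theorem exists_delayed_solution (hF : Measurable (Function.uncurry F))
    (hD : ∀ t x, ‖F t x‖ ≤ D) (hh : 0 < h) (T : ℝ) (x : E) :
    ∃ y : ℝ → E, LipschitzWith D y ∧
      ∀ t ∈ Icc 0 T, y t = x + ∫ s in (0 : ℝ)..t, F s (y (s - h)) := by
  have hlip : ∀ k : ℕ, LipschitzWith D ((delayedPicard F h x)^[k] fun _ => x) := by
    intro k
    induction k with
    | zero => exact (LipschitzWith.const x).weaken zero_le
    | succ k ih =>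
      rw [Function.iterate_succ_apply']
      exact lipschitzWith_delayedPicard hF hD ih.continuous.measurable
  obtain ⟨k, hk⟩ := exists_nat_ge (T / h)
  refine ⟨(delayedPicard F h x)^[k] fun _ => x, hlip k, fun t ht => ?_⟩
  rw [← delayedPicard_of_nonneg ht.1]
  exact (eqOn_delayedPicard_iterate k (ht.2.trans ((div_le_iff₀ hh).1 hk))).symm

end Peano

section Compactness

theorem tendsto_apply_of_lipschitzWith {α β ι : Type*} [PseudoMetricSpace α] [PseudoMetricSpace β]
    {l : Filter ι} {K : NNReal} {f : ι → α → β} (hf : ∀ i, LipschitzWith K (f i)) {s : ι → α}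
    {a : α} {b : β} (hs : Tendsto s l (𝓝 a)) (hfa : Tendsto (fun i => f i a) l (𝓝 b)) :
    Tendsto (fun i => f i (s i)) l (𝓝 b) := by
  refine (tendsto_iff_of_dist ?_).1 hfa
  refine squeeze_zero (fun _ => dist_nonneg) (fun i => (hf i).dist_le_mul a (s i)) ?_
  simpa using ((tendsto_const_nhds (x := a)).dist hs).const_mul (K : ℝ)

theorem exists_subseq_tendsto_of_lipschitzWith {E : Type*} [MetricSpace E] [ProperSpace E]
    {K : NNReal} {f : ℕ → ℝ → E} (hf : ∀ n, LipschitzWith K (f n)) {a b : ℝ} (hab : a ≤ b) {x : E}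
    (hfa : ∀ n, f n a = x) :
    ∃ g : ℝ → E, Continuous g ∧ ∃ φ : ℕ → ℕ, StrictMono φ ∧
      ∀ t ∈ Icc a b, Tendsto (fun n => f (φ n) t) atTop (𝓝 (g t)) := by
  let F : ℕ → BoundedContinuousFunction (Icc a b) E := fun n =>
    .mkOfCompact ⟨fun t => f n t, (hf n).continuous.comp continuous_subtype_val⟩
  have hcompact : IsCompact (closure (range F)) := by
    refine BoundedContinuousFunction.arzela_ascoli (Metric.closedBall x (K * (b - a)))
      (isCompact_closedBall _ _) _ ?_ ?_
    · rintro _ t ⟨n, rfl⟩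
      rw [Metric.mem_closedBall, ← hfa n]
      refine ((hf n).dist_le_mul t a).trans (mul_le_mul_of_nonneg_left ?_ K.2)
      rw [Real.dist_eq, abs_of_nonneg (sub_nonneg.2 t.2.1)]
      exact sub_le_sub_right t.2.2 a
    · refine (LipschitzWith.uniformEquicontinuous _ K ?_).equicontinuous
      rintro ⟨_, n, rfl⟩
      exact LipschitzWith.of_dist_le_mul fun s t => (hf n).dist_le_mul s t
  obtain ⟨G, -, φ, hφ, hG⟩ := hcompact.tendsto_subseq fun n => subset_closure (mem_range_self n)
  refine ⟨IccExtend hab G, G.continuous.Icc_extend', φ, hφ, fun t ht => ?_⟩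
  rw [IccExtend_of_mem hab G ht]
  exact ((continuous_eval_const _).tendsto G).comp hG

end Compactness

section Existence

variable {E : Type*} [NormedAddCommGroup E]

/- A limit of solutions of the delayed equations, as the delay tends to `0`. -/
theorem exists_solution_until_exit [NormedSpace ℝ E] [FiniteDimensional ℝ E] [MeasurableSpace E]
    [BorelSpace E] {F : ℝ → E → E} {D : NNReal} (hF : Measurable (Function.uncurry F))
    (hD : ∀ t x, ‖F t x‖ ≤ D) {T : ℝ} (hT : 0 ≤ T) (x : E) {U : Set E} (hU : IsOpen U)
    (hc : ∀ t ∈ Ico 0 T, ContinuousOn (F t) U) :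
    ∃ z : ℝ → E, Continuous z ∧ z 0 = x ∧
      ∀ τ ∈ Icc 0 T, (∀ s ∈ Ico 0 τ, z s ∈ U) → z τ = x + ∫ s in (0 : ℝ)..τ, F s (z s) := by
  have : ProperSpace E := FiniteDimensional.proper ℝ E
  choose y hlip hy using fun n : ℕ =>
    exists_delayed_solution hF hD (Nat.one_div_pos_of_nat (n := n)) T x
  have hy0 : ∀ n, y n 0 = x := fun n => by
    rw [hy n 0 ⟨le_rfl, hT⟩, intervalIntegral.integral_same, add_zero]
  obtain ⟨z, hzc, φ, hφ, hz⟩ := exists_subseq_tendsto_of_lipschitzWith hlip hT hy0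
  have hdelay : ∀ t ∈ Icc 0 T,
      Tendsto (fun n => y (φ n) (t - 1 / ((φ n : ℝ) + 1))) atTop (𝓝 (z t)) := fun t ht => by
    refine tendsto_apply_of_lipschitzWith (fun n => hlip (φ n)) ?_ (hz t ht)
    simpa using (tendsto_const_nhds (x := t)).sub
      ((tendsto_one_div_add_atTop_nhds_zero_nat (𝕜 := ℝ)).comp hφ.tendsto_atTop)
  refine ⟨z, hzc, ?_, fun τ hτ hin => ?_⟩
  · exact tendsto_nhds_unique (hz 0 ⟨le_rfl, hT⟩) (by simp only [hy0, tendsto_const_nhds])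
  · refine tendsto_nhds_unique (hz τ hτ) ?_
    simp_rw [fun n => hy (φ n) τ hτ]
    refine Tendsto.const_add x ?_
    refine intervalIntegral.tendsto_integral_filter_of_dominated_convergence (fun _ => D)
      (.of_forall fun n => ?_) (.of_forall fun n => .of_forall fun s _ => hD _ _)
      intervalIntegrable_const ?_
    · exact (hF.comp (measurable_id.prodMk ((hlip (φ n)).continuous.measurable.comp
        (measurable_id.sub_const _)))).aestronglyMeasurable
    · filter_upwards [Measure.ae_ne volume τ] with s hsτ hs
      rw [uIoc_of_le hτ.1] at hs
      have hs' : s ∈ Ico 0 τ := ⟨hs.1.le, hs.2.lt_of_ne hsτ⟩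
      exact ((hc s ⟨hs'.1, hs'.2.trans_le hτ.2⟩).continuousAt
        (hU.mem_nhds (hin s hs'))).tendsto.comp (hdelay s ⟨hs'.1, hs'.2.le.trans hτ.2⟩)

theorem mapsTo_Ico_of_isOpen {X : Type*} [TopologicalSpace X] {z : ℝ → X} {a b : ℝ} {U : Set X}
    (hz : ContinuousOn z (Ico a b)) (hU : IsOpen U)
    (hstep : ∀ τ ∈ Ico a b, (∀ s ∈ Ico a τ, z s ∈ U) → z τ ∈ U) : MapsTo z (Ico a b) U := by
  intro t ht
  by_contra htU
  have hclosed : IsClosed (Icc a t ∩ z ⁻¹' Uᶜ) :=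
    (hz.mono (Icc_subset_Ico_right ht.2)).preimage_isClosed_of_isClosed isClosed_Icc
      hU.isClosed_compl
  obtain ⟨τ, ⟨hτ, hτU⟩, hfirst⟩ := (isCompact_Icc.of_isClosed_subset hclosed
    inter_subset_left).exists_isLeast ⟨t, ⟨ht.1, le_rfl⟩, htU⟩
  refine hτU (hstep τ ⟨hτ.1, hτ.2.trans_lt ht.2⟩ fun s hs => ?_)
  by_contra hsU
  exact (hfirst ⟨⟨hs.1, hs.2.le.trans hτ.2⟩, hsU⟩).not_gt hs.2

end Existence

section AdmissibleDisplacements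

variable {E : Type*} [NormedAddCommGroup E] [NormedSpace ℝ E] {Ω : Set E} {t : ℝ} {z z' δ : E}

/-- The displacements `δ` of the segments with endpoints in `Ω` that pass through `z` at time `t`:
both `z - t δ` and `z + (1 - t) δ` are in `Ω`. -/
def admissible (Ω : Set E) (t : ℝ) (z : E) : Set E :=
  {δ | z - t • δ ∈ Ω ∧ z + (1 - t) • δ ∈ Ω}

theorem norm_le_diam_of_mem_admissible (hΩ : Bornology.IsBounded Ω) (hδ : δ ∈ admissible Ω t z) :
    ‖δ‖ ≤ Metric.diam Ω := by
  have hsub : z + (1 - t) • δ - (z - t • δ) = δ := by module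
  simpa only [dist_eq_norm, hsub] using Metric.dist_le_diam_of_mem hΩ hδ.2 hδ.1

theorem closedBall_subset_admissible (ht : t ∈ Icc (0 : ℝ) 1) {r : ℝ}
    (hz : Metric.closedBall z r ⊆ Ω) : Metric.closedBall 0 r ⊆ admissible Ω t z := by
  intro δ hδ
  rw [mem_closedBall_zero_iff] at hδ
  have hscale : ∀ s ∈ Icc (0 : ℝ) 1, ‖s • δ‖ ≤ r := fun s hs => by
    rw [norm_smul, Real.norm_of_nonneg hs.1]
    exact (mul_le_of_le_one_left (norm_nonneg _) hs.2).trans hδ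
  constructor
  · refine hz ?_
    rw [mem_closedBall_iff_norm, sub_sub_cancel_left, norm_neg]
    exact hscale t ht
  · refine hz ?_
    rw [mem_closedBall_iff_norm, add_sub_cancel_left]
    exact hscale (1 - t) ⟨sub_nonneg.2 ht.2, sub_le_self 1 ht.1⟩

theorem measureReal_admissible_le [ProperSpace E] [MeasurableSpace E] (μ : Measure E)
    [IsFiniteMeasureOnCompacts μ] (hΩ : Bornology.IsBounded Ω) (t : ℝ) (z : E) :
    μ.real (admissible Ω t z) ≤ μ.real (Metric.closedBall 0 (Metric.diam Ω)) :=
  measureReal_mono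
    (fun _ hδ => mem_closedBall_zero_iff.2 (norm_le_diam_of_mem_admissible hΩ hδ))
    (isCompact_closedBall _ _).measure_lt_top.ne

theorem admissible_eq_image (Ω : Set E) (t : ℝ) (z : E) :
    admissible Ω t z = (fun q : E × E => q.2 - q.1) ''
      (Ω ×ˢ Ω ∩ {q | (1 - t) • q.1 + t • q.2 = z}) := by
  ext δ
  constructor
  · refine fun hδ => ⟨(z - t • δ, z + (1 - t) • δ), ⟨hδ, ?_⟩, ?_⟩
    · change (1 - t) • (z - t • δ) + t • (z + (1 - t) • δ) = z
      module
    · module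
  · rintro ⟨⟨a, b⟩, ⟨⟨ha, hb⟩, rfl⟩, rfl⟩
    constructor
    · convert ha using 1
      module
    · convert hb using 1
      module

theorem isCompact_admissible (hΩ : IsCompact Ω) (t : ℝ) (z : E) :
    IsCompact (admissible Ω t z) := by
  rw [admissible_eq_image]
  exact ((hΩ.prod hΩ).inter_right (isClosed_eq (by fun_prop) continuous_const)).image (by fun_prop)

theorem one_sub_smul_mem_admissible (hΩ : Convex ℝ Ω) {s : ℝ} (hs₀ : 0 ≤ s) (hs₁ : s ≤ 1) {u : E}
    (hu : z + u ∈ Ω) (hδ : δ ∈ admissible Ω t z) : (1 - s) • δ ∈ admissible Ω t (z + s • u) := by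
  constructor
  · convert hΩ hδ.1 hu (sub_nonneg.2 hs₁) hs₀ (sub_add_cancel 1 s) using 1
    module
  · convert hΩ hδ.2 hu (sub_nonneg.2 hs₁) hs₀ (sub_add_cancel 1 s) using 1
    module

theorem starConvex_admissible (hΩ : Convex ℝ Ω) (hz : z ∈ Ω) :
    StarConvex ℝ 0 (admissible Ω t z) := by
  refine starConvex_zero_iff.2 fun δ hδ a ha₀ ha₁ => ?_
  simpa using one_sub_smul_mem_admissible hΩ (sub_nonneg.2 ha₁) (sub_le_self 1 ha₀)
    (by rwa [add_zero] : z + 0 ∈ Ω) hδ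

theorem exists_mem_closedBall_eq_add_smul {r : ℝ} (hr : 0 < r) (z z' : E) :
    ∃ w ∈ Metric.closedBall z r, z' = z + (‖z' - z‖ / r) • (w - z) := by
  rcases eq_or_ne z' z with rfl | hne
  · exact ⟨z', Metric.mem_closedBall_self hr.le, by simp⟩
  · have hpos : 0 < ‖z' - z‖ := norm_pos_iff.2 (sub_ne_zero.2 hne)
    refine ⟨z + (r / ‖z' - z‖) • (z' - z), ?_, ?_⟩
    · rw [mem_closedBall_iff_norm, add_sub_cancel_left, norm_smul,
        Real.norm_of_nonneg (by positivity), div_mul_cancel₀ r hpos.ne']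
    · rw [add_sub_cancel_left, smul_smul, div_mul_div_cancel₀ hr.ne', div_self hpos.ne', one_smul,
        add_sub_cancel]

variable [FiniteDimensional ℝ E] [MeasurableSpace E] [BorelSpace E] (μ : Measure E)
  [μ.IsAddHaarMeasure]

open scoped Pointwise in
theorem measureReal_diff_one_sub_smul_le {A : Set E} (hA : IsCompact A) (hstar : StarConvex ℝ 0 A)
    {s : ℝ} (hs₀ : 0 ≤ s) (hs₁ : s ≤ 1) :
    μ.real (A \ (1 - s) • A) ≤ Module.finrank ℝ E * s * μ.real A := by
  have hsubset : (1 - s) • A ⊆ A := smul_set_subset_iff.2 fun δ hδ =>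
    starConvex_zero_iff.1 hstar hδ (sub_nonneg.2 hs₁) (sub_le_self 1 hs₀)
  have hsmul : μ.real ((1 - s) • A) = (1 - s) ^ Module.finrank ℝ E * μ.real A := by
    rw [measureReal_def, Measure.addHaar_smul, ENNReal.toReal_mul,
      ENNReal.toReal_ofReal (abs_nonneg _), abs_of_nonneg (pow_nonneg (sub_nonneg.2 hs₁) _),
      measureReal_def]
  have hbernoulli := one_add_mul_le_pow (a := -s) (by linarith) (Module.finrank ℝ E)
  rw [← sub_eq_add_neg] at hbernoulli
  rw [measureReal_sdiff hsubset (hA.smul (1 - s)).measurableSet hA.measure_lt_top.ne, hsmul]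
  linarith [mul_le_mul_of_nonneg_right hbernoulli (measureReal_nonneg (μ := μ) (s := A))]

/- Moving `z` to `z' = z + s (w - z)` with `w ∈ Ω` keeps `(1 - s) δ` admissible by convexity. -/
theorem measureReal_admissible_diff_le (hΩ : IsCompact Ω) (hconv : Convex ℝ Ω) {r : ℝ}
    (hr : 0 < r) (hz : Metric.closedBall z r ⊆ Ω) (hzz' : ‖z' - z‖ ≤ r) (t : ℝ) :
    μ.real (admissible Ω t z \ admissible Ω t z') ≤
      Module.finrank ℝ E * (‖z' - z‖ / r) * μ.real (Metric.closedBall 0 (Metric.diam Ω)) := by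
  have : ProperSpace E := FiniteDimensional.proper ℝ E
  obtain ⟨w, hw, hz'⟩ := exists_mem_closedBall_eq_add_smul hr z z'
  set s := ‖z' - z‖ / r
  have hs₀ : 0 ≤ s := by positivity
  have hs₁ : s ≤ 1 := (div_le_one hr).2 hzz'
  have hA : IsCompact (admissible Ω t z) := isCompact_admissible hΩ t z
  have hstar : StarConvex ℝ 0 (admissible Ω t z) :=
    starConvex_admissible hconv (hz (Metric.mem_closedBall_self hr.le))
  open scoped Pointwise in
  have hsubset : (1 - s) • admissible Ω t z ⊆ admissible Ω t z' :=
    smul_set_subset_iff.2 fun δ hδ => by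
      rw [hz']
      exact one_sub_smul_mem_admissible hconv hs₀ hs₁ (by rw [add_sub_cancel]; exact hz hw) hδ
  refine (measureReal_mono (sdiff_subset_sdiff_right hsubset)
    ((measure_mono sdiff_subset).trans_lt hA.measure_lt_top).ne).trans ?_
  refine (measureReal_diff_one_sub_smul_le μ hA hstar hs₀ hs₁).trans ?_
  exact mul_le_mul_of_nonneg_left (measureReal_admissible_le μ hΩ.isBounded t z) (by positivity)

theorem measureReal_symmDiff_admissible_le (hΩ : IsCompact Ω) (hconv : Convex ℝ Ω) {r : ℝ}
    (hr : 0 < r) (hz : Metric.closedBall z r ⊆ Ω) (hz' : Metric.closedBall z' r ⊆ Ω)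
    (hzz' : ‖z - z'‖ ≤ r) (t : ℝ) :
    μ.real (symmDiff (admissible Ω t z) (admissible Ω t z')) ≤
      2 * (Module.finrank ℝ E * (‖z - z'‖ / r) *
        μ.real (Metric.closedBall 0 (Metric.diam Ω))) := by
  have h := measureReal_admissible_diff_le μ hΩ hconv hr hz (by rwa [norm_sub_rev]) t
  have h' := measureReal_admissible_diff_le μ hΩ hconv hr hz' hzz' t
  rw [norm_sub_rev] at h
  exact (measureReal_union_le _ _).trans (by linarith)

end AdmissibleDisplacements

section RegularDensities

variable {d : ℕ} {Ω : Set (EuclideanSpace ℝ (Fin d))} {p : EuclideanSpace ℝ (Fin d) → ℝ}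
  {x x' : EuclideanSpace ℝ (Fin d)}

namespace IsRegularDensityOn

theorem nonneg (h : IsRegularDensityOn Ω p) (x : EuclideanSpace ℝ (Fin d)) : 0 ≤ p x := by
  obtain ⟨c, hc, hle⟩ := h.bounded_away
  by_cases hx : x ∈ Ω
  · exact hc.le.trans (hle x hx)
  · exact (h.eq_zero_off x hx).ge

theorem pos (h : IsRegularDensityOn Ω p) (hx : x ∈ Ω) : 0 < p x := by
  obtain ⟨c, hc, hle⟩ := h.bounded_away
  exact hc.trans_le (hle x hx)

theorem mem_of_ne_zero (h : IsRegularDensityOn Ω p) (hx : p x ≠ 0) : x ∈ Ω :=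
  not_imp_comm.1 (h.eq_zero_off x) hx

theorem exists_le (h : IsRegularDensityOn Ω p) (hΩ : IsCompact Ω) :
    ∃ M, 0 ≤ M ∧ ∀ x, p x ≤ M := by
  obtain ⟨M, hM⟩ := hΩ.bddAbove_image h.continuousOn
  refine ⟨max M 0, le_max_right _ _, fun x => ?_⟩
  by_cases hx : x ∈ Ω
  · exact (hM (mem_image_of_mem p hx)).trans (le_max_left _ _)
  · exact (h.eq_zero_off x hx).le.trans (le_max_right _ _)

theorem measurable (h : IsRegularDensityOn Ω p) (hΩ : MeasurableSet Ω) : Measurable p := by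
  classical
  have hp : p = Ω.piecewise p 0 := by
    ext x
    by_cases hx : x ∈ Ω
    · rw [piecewise_eq_of_mem _ _ _ hx]
    · rw [piecewise_eq_of_notMem _ _ _ hx, h.eq_zero_off x hx, Pi.zero_apply]
  rw [hp]
  exact h.continuousOn.measurable_piecewise continuousOn_const hΩ

theorem continuousAt (h : IsRegularDensityOn Ω p) (hx : x ∉ frontier Ω) : ContinuousAt p x := by
  by_cases hxi : x ∈ interior Ω
  · exact h.continuousOn.continuousAt (mem_interior_iff_mem_nhds.1 hxi)
  · have hxc : x ∈ (closure Ω)ᶜ := fun hc => hx ⟨hc, hxi⟩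
    refine (continuousAt_const (y := (0 : ℝ))).congr ?_
    filter_upwards [isClosed_closure.isOpen_compl.mem_nhds hxc] with y hy
    exact (h.eq_zero_off y (notMem_subset subset_closure hy)).symm

theorem exists_abs_div_sub_one_le (h : IsRegularDensityOn Ω p) (hΩ : IsCompact Ω) :
    ∃ K, ∀ z ∈ Ω, ∀ z' ∈ Ω, |p z / p z' - 1| ≤ K := by
  obtain ⟨c, hc, hle⟩ := h.bounded_away
  obtain ⟨M, hM, hpM⟩ := h.exists_le hΩ
  refine ⟨M / c + 1, fun z _ z' hz' => ?_⟩
  have hnonneg : 0 ≤ p z / p z' := div_nonneg (h.nonneg _) (h.nonneg _)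
  have hle' : p z / p z' ≤ M / c := div_le_div₀ hM (hpM z) hc (hle z' hz')
  rw [abs_le]
  constructor <;> linarith

theorem abs_sub_le (h : IsRegularDensityOn Ω p) (hx' : x' ∈ Ω) {M w : ℝ} (hM : p x' ≤ M)
    (hw : |p x / p x' - 1| ≤ w) : |p x - p x'| ≤ M * w := by
  have hpos : 0 < p x' := h.pos hx'
  rw [show p x - p x' = p x' * (p x / p x' - 1) by field_simp, abs_mul, abs_of_pos hpos]
  exact mul_le_mul hM hw (abs_nonneg _) (hpos.le.trans hM)

end IsRegularDensityOn

variable {p₀ p₁ : EuclideanSpace ℝ (Fin d) → ℝ}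

theorem densityModulus_nonneg (η : ℝ) : 0 ≤ densityModulus Ω p₀ p₁ η :=
  Real.sSup_nonneg (by
    rintro _ ⟨z, -, z', -, -, rfl⟩
    exact le_max_of_le_left (abs_nonneg _))

theorem max_abs_div_sub_one_le_densityModulus (hΩ : IsCompact Ω)
    (h₀ : IsRegularDensityOn Ω p₀) (h₁ : IsRegularDensityOn Ω p₁) {η : ℝ}
    (hx : x ∈ Ω) (hx' : x' ∈ Ω) (hη : ‖x - x'‖ ≤ η) :
    max |p₀ x / p₀ x' - 1| |p₁ x / p₁ x' - 1| ≤ densityModulus Ω p₀ p₁ η := by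
  obtain ⟨K₀, hK₀⟩ := h₀.exists_abs_div_sub_one_le hΩ
  obtain ⟨K₁, hK₁⟩ := h₁.exists_abs_div_sub_one_le hΩ
  refine le_csSup ⟨max K₀ K₁, ?_⟩ ⟨x, hx, x', hx', hη, rfl⟩
  rintro _ ⟨y, hy, y', hy', -, rfl⟩
  exact max_le_max (hK₀ y hy y' hy') (hK₁ y hy y' hy')

end RegularDensities

section InterpolationKernel

variable {d : ℕ} {Ω : Set (EuclideanSpace ℝ (Fin d))} {p₀ p₁ : EuclideanSpace ℝ (Fin d) → ℝ}
  {t : ℝ} {z δ : EuclideanSpace ℝ (Fin d)}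

/-- The integrand `p₀(z - tδ) p₁(z + (1-t)δ)` of `interpDensity`: the joint density, at `(z, δ)`, of
the interpolant `(1 - t) X₀ + t X₁` and the displacement `X₁ - X₀`. -/
def interpKernel (p₀ p₁ : EuclideanSpace ℝ (Fin d) → ℝ) (t : ℝ)
    (z δ : EuclideanSpace ℝ (Fin d)) : ℝ :=
  p₀ (z - t • δ) * p₁ (z + (1 - t) • δ)

theorem interpKernel_nonneg (h₀ : IsRegularDensityOn Ω p₀) (h₁ : IsRegularDensityOn Ω p₁)
    (t : ℝ) (z δ : EuclideanSpace ℝ (Fin d)) : 0 ≤ interpKernel p₀ p₁ t z δ :=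
  mul_nonneg (h₀.nonneg _) (h₁.nonneg _)

theorem interpKernel_le (h₀ : IsRegularDensityOn Ω p₀) (h₁ : IsRegularDensityOn Ω p₁)
    {M₀ M₁ : ℝ} (hM₀ : ∀ x, p₀ x ≤ M₀) (hM₁ : ∀ x, p₁ x ≤ M₁) (t : ℝ)
    (z δ : EuclideanSpace ℝ (Fin d)) : interpKernel p₀ p₁ t z δ ≤ M₀ * M₁ :=
  mul_le_mul (hM₀ _) (hM₁ _) (h₁.nonneg _) ((h₀.nonneg _).trans (hM₀ z))

theorem mem_admissible_of_interpKernel_ne_zero (h₀ : IsRegularDensityOn Ω p₀)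
    (h₁ : IsRegularDensityOn Ω p₁) (h : interpKernel p₀ p₁ t z δ ≠ 0) : δ ∈ admissible Ω t z :=
  ⟨h₀.mem_of_ne_zero (left_ne_zero_of_mul h), h₁.mem_of_ne_zero (right_ne_zero_of_mul h)⟩

theorem interpKernel_eq_zero (h₀ : IsRegularDensityOn Ω p₀) (h₁ : IsRegularDensityOn Ω p₁)
    (h : δ ∉ admissible Ω t z) : interpKernel p₀ p₁ t z δ = 0 :=
  not_imp_comm.1 (mem_admissible_of_interpKernel_ne_zero h₀ h₁) h

theorem norm_interpKernel_smul_le (hΩ : Bornology.IsBounded Ω) (h₀ : IsRegularDensityOn Ω p₀)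
    (h₁ : IsRegularDensityOn Ω p₁) (t : ℝ) (z δ : EuclideanSpace ℝ (Fin d)) :
    ‖interpKernel p₀ p₁ t z δ • δ‖ ≤ interpKernel p₀ p₁ t z δ * Metric.diam Ω := by
  have hk := interpKernel_nonneg h₀ h₁ t z δ
  rw [norm_smul, Real.norm_of_nonneg hk]
  by_cases hδ : δ ∈ admissible Ω t z
  · exact mul_le_mul_of_nonneg_left (norm_le_diam_of_mem_admissible hΩ hδ) hk
  · rw [interpKernel_eq_zero h₀ h₁ hδ, zero_mul, zero_mul]

theorem measurable_interpKernel (hΩ : MeasurableSet Ω) (h₀ : IsRegularDensityOn Ω p₀)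
    (h₁ : IsRegularDensityOn Ω p₁) :
    Measurable fun q : (ℝ × EuclideanSpace ℝ (Fin d)) × EuclideanSpace ℝ (Fin d) =>
      interpKernel p₀ p₁ q.1.1 q.1.2 q.2 :=
  ((h₀.measurable hΩ).comp (by fun_prop)).mul ((h₁.measurable hΩ).comp (by fun_prop))

theorem measurable_interpKernel_apply (hΩ : MeasurableSet Ω) (h₀ : IsRegularDensityOn Ω p₀)
    (h₁ : IsRegularDensityOn Ω p₁) (t : ℝ) (z : EuclideanSpace ℝ (Fin d)) :
    Measurable (interpKernel p₀ p₁ t z) :=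
  (measurable_interpKernel hΩ h₀ h₁).comp (measurable_prodMk_left (x := (t, z)))

theorem exists_integrable_interpKernel_le (hΩ : IsCompact Ω) (h₀ : IsRegularDensityOn Ω p₀)
    (h₁ : IsRegularDensityOn Ω p₁) :
    ∃ B : EuclideanSpace ℝ (Fin d) → ℝ, Integrable B ∧
      ∀ t z δ, interpKernel p₀ p₁ t z δ ≤ B δ := by
  obtain ⟨M₀, hM₀, hle₀⟩ := h₀.exists_le hΩ
  obtain ⟨M₁, hM₁, hle₁⟩ := h₁.exists_le hΩ
  refine ⟨(Metric.closedBall 0 (Metric.diam Ω)).indicator fun _ => M₀ * M₁, ?_, fun t z δ => ?_⟩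
  · exact (integrable_indicator_iff Metric.isClosed_closedBall.measurableSet).2
      (integrableOn_const (isCompact_closedBall _ _).measure_lt_top.ne)
  by_cases hδ : δ ∈ admissible Ω t z
  · rw [indicator_of_mem (mem_closedBall_zero_iff.2
      (norm_le_diam_of_mem_admissible hΩ.isBounded hδ))]
    exact interpKernel_le h₀ h₁ hle₀ hle₁ t z δ
  · rw [interpKernel_eq_zero h₀ h₁ hδ]
    exact indicator_nonneg (fun _ _ => mul_nonneg hM₀ hM₁) δ

theorem integrable_interpKernel (hΩ : IsCompact Ω) (h₀ : IsRegularDensityOn Ω p₀)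
    (h₁ : IsRegularDensityOn Ω p₁) (t : ℝ) (z : EuclideanSpace ℝ (Fin d)) :
    Integrable (interpKernel p₀ p₁ t z) := by
  obtain ⟨B, hB, hle⟩ := exists_integrable_interpKernel_le hΩ h₀ h₁
  refine hB.mono' (measurable_interpKernel_apply hΩ.measurableSet h₀ h₁ t z).aestronglyMeasurable
    (.of_forall fun δ => ?_)
  rw [Real.norm_of_nonneg (interpKernel_nonneg h₀ h₁ t z δ)]
  exact hle t z δ

theorem integrable_interpKernel_smul (hΩ : IsCompact Ω) (h₀ : IsRegularDensityOn Ω p₀)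
    (h₁ : IsRegularDensityOn Ω p₁) (t : ℝ) (z : EuclideanSpace ℝ (Fin d)) :
    Integrable fun δ => interpKernel p₀ p₁ t z δ • δ :=
  ((integrable_interpKernel hΩ h₀ h₁ t z).mul_const (Metric.diam Ω)).mono'
    ((measurable_interpKernel_apply hΩ.measurableSet h₀ h₁ t z).smul
      measurable_id).aestronglyMeasurable
    (.of_forall (norm_interpKernel_smul_le hΩ.isBounded h₀ h₁ t z))

end InterpolationKernel

section Velocity

variable {d : ℕ} {Ω : Set (EuclideanSpace ℝ (Fin d))} {p₀ p₁ : EuclideanSpace ℝ (Fin d) → ℝ}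
  {t : ℝ} {z : EuclideanSpace ℝ (Fin d)}

theorem interpDensity_nonneg (h₀ : IsRegularDensityOn Ω p₀) (h₁ : IsRegularDensityOn Ω p₁)
    (t : ℝ) (z : EuclideanSpace ℝ (Fin d)) : 0 ≤ interpDensity p₀ p₁ t z :=
  integral_nonneg (interpKernel_nonneg h₀ h₁ t z)

theorem norm_interpFlux_le (hΩ : IsCompact Ω) (h₀ : IsRegularDensityOn Ω p₀)
    (h₁ : IsRegularDensityOn Ω p₁) (t : ℝ) (z : EuclideanSpace ℝ (Fin d)) :
    ‖interpFlux p₀ p₁ t z‖ ≤ interpDensity p₀ p₁ t z * Metric.diam Ω := by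
  rw [interpDensity, ← integral_mul_const]
  exact norm_integral_le_of_norm_le ((integrable_interpKernel hΩ h₀ h₁ t z).mul_const _)
    (.of_forall (norm_interpKernel_smul_le hΩ.isBounded h₀ h₁ t z))

theorem interpDensity_smul_velocity (hΩ : IsCompact Ω) (h₀ : IsRegularDensityOn Ω p₀)
    (h₁ : IsRegularDensityOn Ω p₁) (t : ℝ) (z : EuclideanSpace ℝ (Fin d)) :
    interpDensity p₀ p₁ t z • velocity p₀ p₁ t z = interpFlux p₀ p₁ t z := by
  by_cases h : interpDensity p₀ p₁ t z = 0
  · have hflux := norm_interpFlux_le hΩ h₀ h₁ t z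
    rw [h, zero_mul, norm_le_zero_iff] at hflux
    rw [h, hflux, zero_smul]
  · rw [velocity, smul_inv_smul₀ h]

theorem norm_velocity_le (hΩ : IsCompact Ω) (h₀ : IsRegularDensityOn Ω p₀)
    (h₁ : IsRegularDensityOn Ω p₁) (t : ℝ) (z : EuclideanSpace ℝ (Fin d)) :
    ‖velocity p₀ p₁ t z‖ ≤ Metric.diam Ω := by
  have hdensity := interpDensity_nonneg h₀ h₁ t z
  rw [velocity, norm_smul, norm_inv, Real.norm_of_nonneg hdensity]
  exact inv_mul_le_of_le_mul₀ hdensity Metric.diam_nonneg (norm_interpFlux_le hΩ h₀ h₁ t z)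

theorem measurable_velocity (hΩ : MeasurableSet Ω) (h₀ : IsRegularDensityOn Ω p₀)
    (h₁ : IsRegularDensityOn Ω p₁) : Measurable (Function.uncurry (velocity p₀ p₁)) := by
  have hk := measurable_interpKernel hΩ h₀ h₁
  have hdensity : Measurable (Function.uncurry (interpDensity p₀ p₁)) :=
    hk.stronglyMeasurable.integral_prod_right'.measurable
  have hflux : Measurable (Function.uncurry (interpFlux p₀ p₁)) :=
    (hk.smul measurable_snd).stronglyMeasurable.integral_prod_right'.measurable
  exact hdensity.inv.smul hflux

theorem le_interpDensity (hΩ : IsCompact Ω) (h₀ : IsRegularDensityOn Ω p₀)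
    (h₁ : IsRegularDensityOn Ω p₁) {c₀ c₁ r : ℝ} (hc₁ : 0 ≤ c₁)
    (hle₀ : ∀ x ∈ Ω, c₀ ≤ p₀ x) (hle₁ : ∀ x ∈ Ω, c₁ ≤ p₁ x) (ht : t ∈ Icc (0 : ℝ) 1)
    (hz : Metric.closedBall z r ⊆ Ω) :
    volume.real (Metric.closedBall (0 : EuclideanSpace ℝ (Fin d)) r) * (c₀ * c₁) ≤
      interpDensity p₀ p₁ t z := by
  have hball : MeasurableSet (Metric.closedBall (0 : EuclideanSpace ℝ (Fin d)) r) :=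
    Metric.isClosed_closedBall.measurableSet
  rw [← smul_eq_mul, ← setIntegral_const, ← integral_indicator hball]
  refine integral_mono ((integrable_indicator_iff hball).2
    (integrableOn_const (isCompact_closedBall _ _).measure_lt_top.ne))
    (integrable_interpKernel hΩ h₀ h₁ t z) fun δ => ?_
  refine indicator_apply_le' (fun hδ => ?_) fun _ => interpKernel_nonneg h₀ h₁ t z δ
  obtain ⟨hmem₀, hmem₁⟩ := closedBall_subset_admissible ht hz hδ
  exact mul_le_mul (hle₀ _ hmem₀) (hle₁ _ hmem₁) hc₁ (h₀.nonneg _)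

theorem exists_pos_le_interpDensity (hΩ : IsCompact Ω) (h₀ : IsRegularDensityOn Ω p₀)
    (h₁ : IsRegularDensityOn Ω p₁) {r : ℝ} (hr : 0 < r) :
    ∃ m, 0 < m ∧ ∀ t ∈ Icc (0 : ℝ) 1, ∀ z, Metric.closedBall z r ⊆ Ω →
      m ≤ interpDensity p₀ p₁ t z := by
  obtain ⟨c₀, hc₀, hle₀⟩ := h₀.bounded_away
  obtain ⟨c₁, hc₁, hle₁⟩ := h₁.bounded_away
  have hvolume : 0 < volume.real (Metric.closedBall (0 : EuclideanSpace ℝ (Fin d)) r) :=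
    ENNReal.toReal_pos (Metric.measure_closedBall_pos _ _ hr).ne'
      (isCompact_closedBall _ _).measure_lt_top.ne
  exact ⟨_, mul_pos hvolume (mul_pos hc₀ hc₁),
    fun t ht z hz => le_interpDensity hΩ h₀ h₁ hc₁.le hle₀ hle₁ ht hz⟩

theorem interpDensity_pos (hΩ : IsCompact Ω) (h₀ : IsRegularDensityOn Ω p₀)
    (h₁ : IsRegularDensityOn Ω p₁) (ht : t ∈ Icc (0 : ℝ) 1) (hz : z ∈ interior Ω) :
    0 < interpDensity p₀ p₁ t z := by
  obtain ⟨r, hr, hball⟩ := Metric.nhds_basis_closedBall.mem_iff.1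
    (mem_interior_iff_mem_nhds.1 hz)
  obtain ⟨m, hm, hle⟩ := exists_pos_le_interpDensity hΩ h₀ h₁ hr
  exact hm.trans_le (hle t ht z hball)

theorem add_smul_velocity_mem (hΩ : IsCompact Ω) (hconv : Convex ℝ Ω)
    (h₀ : IsRegularDensityOn Ω p₀) (h₁ : IsRegularDensityOn Ω p₁) (ht : t ∈ Icc (0 : ℝ) 1)
    (hz : z ∈ interior Ω) : z + (1 - t) • velocity p₀ p₁ t z ∈ Ω := by
  have hk := integrable_interpKernel hΩ h₀ h₁ t z
  have hk' : Integrable fun δ => (1 - t) • interpKernel p₀ p₁ t z δ • δ :=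
    (integrable_interpKernel_smul hΩ h₀ h₁ t z).smul (1 - t)
  have hpos := interpDensity_pos hΩ h₀ h₁ ht hz
  have hsmul : ∀ δ, interpKernel p₀ p₁ t z δ • (z + (1 - t) • δ) =
      interpKernel p₀ p₁ t z δ • z + (1 - t) • interpKernel p₀ p₁ t z δ • δ := fun δ => by
    rw [smul_add, smul_comm (1 - t)]
  have hint : ∫ δ, interpKernel p₀ p₁ t z δ • (z + (1 - t) • δ) =
      interpDensity p₀ p₁ t z • z + (1 - t) • interpFlux p₀ p₁ t z := by
    simp only [hsmul]
    rw [integral_add (hk.smul_const z) hk', integral_smul_const, integral_smul]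
    rfl
  have hmem := inv_integral_smul_integral_smul_mem hconv hΩ.isClosed
    (interpKernel_nonneg h₀ h₁ t z) hk hpos
    (.of_forall fun δ hδ => (mem_admissible_of_interpKernel_ne_zero h₀ h₁ hδ).2)
    (((hk.smul_const z).add hk').congr (.of_forall fun δ => (hsmul δ).symm))
  change (interpDensity p₀ p₁ t z)⁻¹ • _ ∈ Ω at hmem
  rwa [hint, smul_add, inv_smul_smul₀ hpos.ne', smul_comm] at hmem

theorem ae_add_smul_notMem {E : Type*} [NormedAddCommGroup E] [NormedSpace ℝ E]
    [FiniteDimensional ℝ E] [MeasurableSpace E] [BorelSpace E] {μ : Measure E}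
    [μ.IsAddHaarMeasure] {S : Set E} (hS : μ S = 0) {r : ℝ} (hr : r ≠ 0) (z : E) :
    ∀ᵐ δ ∂μ, z + r • δ ∉ S := by
  rw [ae_iff]
  simp only [not_not]
  change μ ((r • ·) ⁻¹' ((z + ·) ⁻¹' S)) = 0
  rw [Measure.addHaar_preimage_smul _ hr, measure_preimage_add, hS, mul_zero]

/- The endpoints `z - tδ` and `z + (1-t)δ` avoid the frontier, where the densities may jump: it is
null by convexity, and an endpoint that does not depend on `δ` is `z` itself. -/
theorem ae_continuousAt_interpKernel (hΩ : Convex ℝ Ω) (h₀ : IsRegularDensityOn Ω p₀)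
    (h₁ : IsRegularDensityOn Ω p₁) (t : ℝ) (hz : z ∈ interior Ω) :
    ∀ᵐ δ, ContinuousAt
      (fun q : ℝ × EuclideanSpace ℝ (Fin d) => interpKernel p₀ p₁ q.1 q.2 δ) (t, z) := by
  have hfrontier : ∀ s : ℝ, ∀ᵐ δ, z + s • δ ∉ frontier Ω := fun s => by
    rcases eq_or_ne s 0 with rfl | hs
    · simpa using fun h : z ∈ frontier Ω => h.2 hz
    · exact ae_add_smul_notMem (hΩ.addHaar_frontier volume) hs z
  filter_upwards [hfrontier (-t), hfrontier (1 - t)] with δ hδ₀ hδ₁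
  rw [neg_smul, ← sub_eq_add_neg] at hδ₀
  refine ContinuousAt.mul ?_ ?_
  · exact (h₀.continuousAt hδ₀).comp
      (f := fun q : ℝ × EuclideanSpace ℝ (Fin d) => q.2 - q.1 • δ) (x := (t, z)) (by fun_prop)
  · exact (h₁.continuousAt hδ₁).comp
      (f := fun q : ℝ × EuclideanSpace ℝ (Fin d) => q.2 + (1 - q.1) • δ) (x := (t, z))
      (by fun_prop)

theorem continuousAt_uncurry_velocity (hΩ : IsCompact Ω) (hconv : Convex ℝ Ω)
    (h₀ : IsRegularDensityOn Ω p₀) (h₁ : IsRegularDensityOn Ω p₁)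
    (ht : t ∈ Icc (0 : ℝ) 1) (hz : z ∈ interior Ω) :
    ContinuousAt (Function.uncurry (velocity p₀ p₁)) (t, z) := by
  obtain ⟨B, hB, hle⟩ := exists_integrable_interpKernel_le hΩ h₀ h₁
  have hmeas := measurable_interpKernel_apply hΩ.measurableSet h₀ h₁
  have hcont := ae_continuousAt_interpKernel hconv h₀ h₁ t hz
  have hdensity : ContinuousAt (Function.uncurry (interpDensity p₀ p₁)) (t, z) := by
    refine continuousAt_of_dominated (.of_forall fun q => (hmeas q.1 q.2).aestronglyMeasurable)
      (.of_forall fun q => .of_forall fun δ => ?_) hB hcont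
    exact (Real.norm_of_nonneg (interpKernel_nonneg h₀ h₁ q.1 q.2 δ)).trans_le (hle q.1 q.2 δ)
  have hflux : ContinuousAt (Function.uncurry (interpFlux p₀ p₁)) (t, z) := by
    refine continuousAt_of_dominated
      (.of_forall fun q => ((hmeas q.1 q.2).smul measurable_id).aestronglyMeasurable)
      (.of_forall fun q => .of_forall fun δ => ?_) (hB.mul_const (Metric.diam Ω))
      (hcont.mono fun δ hδ => hδ.smul continuousAt_const)
    exact (norm_interpKernel_smul_le hΩ.isBounded h₀ h₁ q.1 q.2 δ).trans
      (mul_le_mul_of_nonneg_right (hle q.1 q.2 δ) Metric.diam_nonneg)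
  exact (hdensity.inv₀ (interpDensity_pos hΩ h₀ h₁ ht hz).ne').smul hflux

theorem continuousOn_velocity (hΩ : IsCompact Ω) (hconv : Convex ℝ Ω)
    (h₀ : IsRegularDensityOn Ω p₀) (h₁ : IsRegularDensityOn Ω p₁)
    (ht : t ∈ Icc (0 : ℝ) 1) : ContinuousOn (velocity p₀ p₁ t) (interior Ω) := fun z hz =>
  ((continuousAt_uncurry_velocity hΩ hconv h₀ h₁ ht hz).comp (f := fun z => (t, z)) (x := z)
    (by fun_prop)).continuousWithinAt

end Velocity

section VelocityModulus

variable {d : ℕ} {Ω : Set (EuclideanSpace ℝ (Fin d))} {p₀ p₁ : EuclideanSpace ℝ (Fin d) → ℝ}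
  {t : ℝ} {z z' δ : EuclideanSpace ℝ (Fin d)}

theorem abs_interpKernel_sub_le_of_mem_admissible (hΩ : IsCompact Ω)
    (h₀ : IsRegularDensityOn Ω p₀) (h₁ : IsRegularDensityOn Ω p₁) {M₀ M₁ : ℝ}
    (hM₀ : ∀ x, p₀ x ≤ M₀) (hM₁ : ∀ x, p₁ x ≤ M₁) (hz : δ ∈ admissible Ω t z)
    (hz' : δ ∈ admissible Ω t z') :
    |interpKernel p₀ p₁ t z δ - interpKernel p₀ p₁ t z' δ| ≤
      2 * (M₀ * M₁) * densityModulus Ω p₀ p₁ ‖z - z'‖ := by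
  have hM₀_nonneg : 0 ≤ M₀ := (h₀.nonneg z).trans (hM₀ z)
  have hω := densityModulus_nonneg (Ω := Ω) (p₀ := p₀) (p₁ := p₁) ‖z - z'‖
  have hdiff₀ : |p₀ (z - t • δ) - p₀ (z' - t • δ)| ≤ M₀ * densityModulus Ω p₀ p₁ ‖z - z'‖ :=
    h₀.abs_sub_le hz'.1 (hM₀ _) ((le_max_left _ _).trans
      (max_abs_div_sub_one_le_densityModulus hΩ h₀ h₁ hz.1 hz'.1
        (by rw [sub_sub_sub_cancel_right])))
  have hdiff₁ : |p₁ (z + (1 - t) • δ) - p₁ (z' + (1 - t) • δ)| ≤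
      M₁ * densityModulus Ω p₀ p₁ ‖z - z'‖ :=
    h₁.abs_sub_le hz'.2 (hM₁ _) ((le_max_right _ _).trans
      (max_abs_div_sub_one_le_densityModulus hΩ h₀ h₁ hz.2 hz'.2
        (by rw [add_sub_add_right_eq_sub])))
  calc |interpKernel p₀ p₁ t z δ - interpKernel p₀ p₁ t z' δ|
      = |(p₀ (z - t • δ) - p₀ (z' - t • δ)) * p₁ (z + (1 - t) • δ) +
          p₀ (z' - t • δ) * (p₁ (z + (1 - t) • δ) - p₁ (z' + (1 - t) • δ))| := by
        simp only [interpKernel]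
        ring_nf
    _ ≤ |p₀ (z - t • δ) - p₀ (z' - t • δ)| * p₁ (z + (1 - t) • δ) +
          p₀ (z' - t • δ) * |p₁ (z + (1 - t) • δ) - p₁ (z' + (1 - t) • δ)| := by
        refine (abs_add_le _ _).trans_eq ?_
        rw [abs_mul, abs_mul, abs_of_nonneg (h₁.nonneg _), abs_of_nonneg (h₀.nonneg _)]
    _ ≤ M₀ * densityModulus Ω p₀ p₁ ‖z - z'‖ * M₁ +
          M₀ * (M₁ * densityModulus Ω p₀ p₁ ‖z - z'‖) :=
        add_le_add
          (mul_le_mul hdiff₀ (hM₁ _) (h₁.nonneg _) (mul_nonneg hM₀_nonneg hω))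
          (mul_le_mul (hM₀ _) hdiff₁ (abs_nonneg _) hM₀_nonneg)
    _ = 2 * (M₀ * M₁) * densityModulus Ω p₀ p₁ ‖z - z'‖ := by ring

theorem abs_interpKernel_sub_le (hΩ : IsCompact Ω)
    (h₀ : IsRegularDensityOn Ω p₀) (h₁ : IsRegularDensityOn Ω p₁) {M₀ M₁ : ℝ}
    (hM₀ : ∀ x, p₀ x ≤ M₀) (hM₁ : ∀ x, p₁ x ≤ M₁) (t : ℝ)
    (z z' δ : EuclideanSpace ℝ (Fin d)) :
    |interpKernel p₀ p₁ t z δ - interpKernel p₀ p₁ t z' δ| ≤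
      (admissible Ω t z).indicator
        (fun _ => 2 * (M₀ * M₁) * densityModulus Ω p₀ p₁ ‖z - z'‖) δ +
      (symmDiff (admissible Ω t z) (admissible Ω t z')).indicator (fun _ => M₀ * M₁) δ := by
  have hM : 0 ≤ M₀ * M₁ :=
    (interpKernel_nonneg h₀ h₁ t z δ).trans (interpKernel_le h₀ h₁ hM₀ hM₁ t z δ)
  have hω := densityModulus_nonneg (Ω := Ω) (p₀ := p₀) (p₁ := p₁) ‖z - z'‖
  have hindicator : ∀ (A : Set (EuclideanSpace ℝ (Fin d))) {a : ℝ}, 0 ≤ a →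
      0 ≤ A.indicator (fun _ => a) δ := fun _ _ ha => indicator_nonneg (fun _ _ => ha) δ
  by_cases hδ : δ ∈ symmDiff (admissible Ω t z) (admissible Ω t z')
  · rw [indicator_of_mem hδ]
    refine le_add_of_nonneg_of_le (hindicator _ (by positivity)) ?_
    exact abs_sub_le_of_nonneg_of_le (interpKernel_nonneg h₀ h₁ t z δ)
      (interpKernel_le h₀ h₁ hM₀ hM₁ t z δ) (interpKernel_nonneg h₀ h₁ t z' δ)
      (interpKernel_le h₀ h₁ hM₀ hM₁ t z' δ)
  · refine le_add_of_le_of_nonneg ?_ (hindicator _ hM)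
    rw [Set.mem_symmDiff, not_or, not_and_not_right, not_and_not_right] at hδ
    by_cases hz : δ ∈ admissible Ω t z
    · rw [indicator_of_mem hz]
      exact abs_interpKernel_sub_le_of_mem_admissible hΩ h₀ h₁ hM₀ hM₁ hz (hδ.1 hz)
    · rw [indicator_of_notMem hz, interpKernel_eq_zero h₀ h₁ hz,
        interpKernel_eq_zero h₀ h₁ (fun hz' => hz (hδ.2 hz')), sub_zero, abs_zero]

theorem integral_abs_interpKernel_sub_le (hΩ : IsCompact Ω)
    (h₀ : IsRegularDensityOn Ω p₀) (h₁ : IsRegularDensityOn Ω p₁) {M₀ M₁ : ℝ}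
    (hM₀ : ∀ x, p₀ x ≤ M₀) (hM₁ : ∀ x, p₁ x ≤ M₁) (t : ℝ)
    (z z' : EuclideanSpace ℝ (Fin d)) :
    ∫ δ, |interpKernel p₀ p₁ t z δ - interpKernel p₀ p₁ t z' δ| ≤
      volume.real (admissible Ω t z) * (2 * (M₀ * M₁) * densityModulus Ω p₀ p₁ ‖z - z'‖) +
      volume.real (symmDiff (admissible Ω t z) (admissible Ω t z')) * (M₀ * M₁) := by
  have hA : ∀ y, IsCompact (admissible Ω t y) := isCompact_admissible hΩ t
  have hmeas := (hA z).measurableSet.symmDiff (hA z').measurableSet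
  have hfinite : volume (symmDiff (admissible Ω t z) (admissible Ω t z')) ≠ ⊤ :=
    ((measure_mono symmDiff_subset_union).trans_lt ((hA z).union (hA z')).measure_lt_top).ne
  rw [← smul_eq_mul, ← smul_eq_mul (a := volume.real (symmDiff _ _)), ← setIntegral_const,
    ← setIntegral_const, ← integral_indicator (hA z).measurableSet, ← integral_indicator hmeas]
  have hint₁ := (integrable_indicator_iff (hA z).measurableSet).2 (integrableOn_const
    (μ := volume) (C := 2 * (M₀ * M₁) * densityModulus Ω p₀ p₁ ‖z - z'‖) (hA z).measure_lt_top.ne)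
  have hint₂ := (integrable_indicator_iff hmeas).2 (integrableOn_const (μ := volume)
    (C := M₀ * M₁) hfinite)
  rw [← integral_add hint₁ hint₂]
  exact integral_mono
    ((integrable_interpKernel hΩ h₀ h₁ t z).sub (integrable_interpKernel hΩ h₀ h₁ t z')).abs
    (hint₁.add hint₂) (abs_interpKernel_sub_le hΩ h₀ h₁ hM₀ hM₁ t z z')

theorem exists_integral_abs_interpKernel_sub_le (hΩ : IsCompact Ω) (hconv : Convex ℝ Ω)
    (h₀ : IsRegularDensityOn Ω p₀) (h₁ : IsRegularDensityOn Ω p₁) {r : ℝ} (hr : 0 < r) :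
    ∃ C, 0 ≤ C ∧ ∀ t z z', Metric.closedBall z r ⊆ Ω → Metric.closedBall z' r ⊆ Ω →
      ‖z - z'‖ ≤ r → ∫ δ, |interpKernel p₀ p₁ t z δ - interpKernel p₀ p₁ t z' δ| ≤
        C * (densityModulus Ω p₀ p₁ ‖z - z'‖ + ‖z - z'‖) := by
  obtain ⟨M₀, hM₀, hle₀⟩ := h₀.exists_le hΩ
  obtain ⟨M₁, hM₁, hle₁⟩ := h₁.exists_le hΩ
  set V := volume.real (Metric.closedBall (0 : EuclideanSpace ℝ (Fin d)) (Metric.diam Ω))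
  have : 0 ≤ V := measureReal_nonneg
  refine ⟨2 * (M₀ * M₁) * V * (1 + d / r), by positivity, fun t z z' hz hz' hzz' => ?_⟩
  set w := densityModulus Ω p₀ p₁ ‖z - z'‖
  have hw : 0 ≤ w := densityModulus_nonneg _
  have hadm : volume.real (admissible Ω t z) ≤ V :=
    measureReal_admissible_le volume hΩ.isBounded t z
  have hsymm : volume.real (symmDiff (admissible Ω t z) (admissible Ω t z')) ≤
      2 * (d * (‖z - z'‖ / r) * V) := by
    simpa only [finrank_euclideanSpace_fin] using
      measureReal_symmDiff_admissible_le volume hΩ hconv hr hz hz' hzz' t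
  calc ∫ δ, |interpKernel p₀ p₁ t z δ - interpKernel p₀ p₁ t z' δ|
      ≤ volume.real (admissible Ω t z) * (2 * (M₀ * M₁) * w) +
          volume.real (symmDiff (admissible Ω t z) (admissible Ω t z')) * (M₀ * M₁) :=
        integral_abs_interpKernel_sub_le hΩ h₀ h₁ hle₀ hle₁ t z z'
    _ ≤ V * (2 * (M₀ * M₁) * w) + 2 * (d * (‖z - z'‖ / r) * V) * (M₀ * M₁) := by gcongr
    _ = 2 * (M₀ * M₁) * V * (w + d / r * ‖z - z'‖) := by ring
    _ ≤ 2 * (M₀ * M₁) * V * ((1 + d / r) * w + (1 + d / r) * ‖z - z'‖) := by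
        gcongr
        · exact le_mul_of_one_le_left hw (le_add_of_nonneg_right (by positivity))
        · exact le_add_of_nonneg_left zero_le_one
    _ = 2 * (M₀ * M₁) * V * (1 + d / r) * (w + ‖z - z'‖) := by ring

theorem interpDensity_smul_velocity_sub (hΩ : IsCompact Ω) (h₀ : IsRegularDensityOn Ω p₀)
    (h₁ : IsRegularDensityOn Ω p₁) (t : ℝ) (z z' : EuclideanSpace ℝ (Fin d)) :
    interpDensity p₀ p₁ t z • (velocity p₀ p₁ t z - velocity p₀ p₁ t z') =
      ∫ δ, (interpKernel p₀ p₁ t z δ - interpKernel p₀ p₁ t z' δ) •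
        (δ - velocity p₀ p₁ t z') := by
  set v' := velocity p₀ p₁ t z' with hv'
  have hk := integrable_interpKernel hΩ h₀ h₁ t
  have hk' := integrable_interpKernel_smul hΩ h₀ h₁ t
  have hint : ∀ y, Integrable fun δ => interpKernel p₀ p₁ t y δ • (δ - v') := fun y => by
    simp only [smul_sub]
    exact (hk' y).sub ((hk y).smul_const v')
  have hintegral : ∀ y, ∫ δ, interpKernel p₀ p₁ t y δ • (δ - v') =
      interpDensity p₀ p₁ t y • (velocity p₀ p₁ t y - v') := fun y => by
    simp only [smul_sub]
    rw [integral_sub (hk' y) ((hk y).smul_const v'), integral_smul_const,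
      interpDensity_smul_velocity hΩ h₀ h₁]
    rfl
  simp only [sub_smul]
  rw [integral_sub (hint z) (hint z'), hintegral, hintegral, ← hv', sub_self, smul_zero, sub_zero]

theorem interpDensity_mul_norm_velocity_sub_le (hΩ : IsCompact Ω)
    (h₀ : IsRegularDensityOn Ω p₀) (h₁ : IsRegularDensityOn Ω p₁) (t : ℝ)
    (z z' : EuclideanSpace ℝ (Fin d)) :
    interpDensity p₀ p₁ t z * ‖velocity p₀ p₁ t z - velocity p₀ p₁ t z'‖ ≤
      2 * Metric.diam Ω * ∫ δ, |interpKernel p₀ p₁ t z δ - interpKernel p₀ p₁ t z' δ| := by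
  rw [← Real.norm_of_nonneg (interpDensity_nonneg h₀ h₁ t z), ← norm_smul,
    interpDensity_smul_velocity_sub hΩ h₀ h₁, ← integral_const_mul]
  refine norm_integral_le_of_norm_le (((integrable_interpKernel hΩ h₀ h₁ t z).sub
    (integrable_interpKernel hΩ h₀ h₁ t z')).abs.const_mul _) (.of_forall fun δ => ?_)
  rw [norm_smul, Real.norm_eq_abs, mul_comm]
  by_cases hδ : ‖δ‖ ≤ Metric.diam Ω
  · refine mul_le_mul_of_nonneg_right ((norm_sub_le _ _).trans ?_) (abs_nonneg _)
    linarith [norm_velocity_le hΩ h₀ h₁ t z']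
  · have hzero : ∀ y, interpKernel p₀ p₁ t y δ = 0 := fun y =>
      interpKernel_eq_zero h₀ h₁ fun h => hδ (norm_le_diam_of_mem_admissible hΩ.isBounded h)
    simp only [hzero, sub_zero, abs_zero, mul_zero, le_refl]

theorem exists_norm_velocity_sub_le (hΩ : IsCompact Ω) (hconv : Convex ℝ Ω)
    (h₀ : IsRegularDensityOn Ω p₀) (h₁ : IsRegularDensityOn Ω p₁) {r : ℝ} (hr : 0 < r) :
    ∃ C, 0 ≤ C ∧ ∀ t ∈ Icc (0 : ℝ) 1, ∀ z z', Metric.closedBall z r ⊆ Ω →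
      Metric.closedBall z' r ⊆ Ω → ‖z - z'‖ ≤ r →
      ‖velocity p₀ p₁ t z - velocity p₀ p₁ t z'‖ ≤
        C * (densityModulus Ω p₀ p₁ ‖z - z'‖ + ‖z - z'‖) := by
  obtain ⟨m, hm, hle⟩ := exists_pos_le_interpDensity hΩ h₀ h₁ hr
  obtain ⟨C, hC, hkernel⟩ := exists_integral_abs_interpKernel_sub_le hΩ hconv h₀ h₁ hr
  refine ⟨2 * Metric.diam Ω * C / m, by positivity, fun t ht z z' hz hz' hzz' => ?_⟩
  rw [div_mul_eq_mul_div, le_div_iff₀' hm]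
  calc m * ‖velocity p₀ p₁ t z - velocity p₀ p₁ t z'‖
      ≤ interpDensity p₀ p₁ t z * ‖velocity p₀ p₁ t z - velocity p₀ p₁ t z'‖ :=
        mul_le_mul_of_nonneg_right (hle t ht z hz) (norm_nonneg _)
    _ ≤ 2 * Metric.diam Ω * ∫ δ, |interpKernel p₀ p₁ t z δ - interpKernel p₀ p₁ t z' δ| :=
        interpDensity_mul_norm_velocity_sub_le hΩ h₀ h₁ t z z'
    _ ≤ 2 * Metric.diam Ω * (C * (densityModulus Ω p₀ p₁ ‖z - z'‖ + ‖z - z'‖)) :=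
        mul_le_mul_of_nonneg_left (hkernel t z z' hz hz' hzz') (by positivity)
    _ = 2 * Metric.diam Ω * C * (densityModulus Ω p₀ p₁ ‖z - z'‖ + ‖z - z'‖) := by ring

end VelocityModulus

section JointDensity

variable {S α E : Type*} [MeasurableSpace S] [MeasurableSpace α] [NormedAddCommGroup E]
  [NormedSpace ℝ E] [MeasurableSpace E] {P : Measure S} {μ : Measure α} {ν : Measure E} [SFinite μ]
  [SFinite ν] {Z : S → α} {Y : S → E} {k : α → E → ℝ}

theorem setIntegral_preimage_eq_of_map_eq_withDensity (hZ : Measurable Z) (hY : Measurable Y)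
    (hk : Measurable (Function.uncurry k)) (hk_nonneg : ∀ z y, 0 ≤ k z y)
    (hlaw : P.map (fun s => (Z s, Y s)) =
      (μ.prod ν).withDensity fun q => ENNReal.ofReal (k q.1 q.2))
    {φ : α × E → E} (hφ : StronglyMeasurable φ) (hint : Integrable (fun s => φ (Z s, Y s)) P)
    {B : Set α} (hB : MeasurableSet B) :
    ∫ s in Z ⁻¹' B, φ (Z s, Y s) ∂P = ∫ z in B, ∫ y, k z y • φ (z, y) ∂ν ∂μ := by
  have hZY : Measurable fun s => (Z s, Y s) := hZ.prodMk hY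
  have hB' : MeasurableSet (B ×ˢ (univ : Set E)) := hB.prod MeasurableSet.univ
  have hdens : Measurable fun q : α × E => ENNReal.ofReal (k q.1 q.2) := hk.ennreal_ofReal
  have hdens_lt : ∀ q : α × E, ENNReal.ofReal (k q.1 q.2) < ⊤ := fun _ => ENNReal.ofReal_lt_top
  have hkφ : Integrable (fun q : α × E => k q.1 q.2 • φ q) (μ.prod ν) := by
    have := (integrable_map_measure hφ.aestronglyMeasurable hZY.aemeasurable).2 hint
    rw [hlaw, integrable_withDensity_iff_integrable_smul' hdens (ae_of_all _ hdens_lt)] at this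
    simpa only [ENNReal.toReal_ofReal (hk_nonneg _ _)] using this
  calc ∫ s in Z ⁻¹' B, φ (Z s, Y s) ∂P
      = ∫ s in (fun s => (Z s, Y s)) ⁻¹' (B ×ˢ univ), φ (Z s, Y s) ∂P := by
        rw [mk_preimage_prod, preimage_univ, inter_univ]
    _ = ∫ q in B ×ˢ univ, k q.1 q.2 • φ q ∂(μ.prod ν) := by
        rw [← setIntegral_map hB' hφ.aestronglyMeasurable hZY.aemeasurable, hlaw,
          setIntegral_withDensity_eq_setIntegral_toReal_smul hdens (ae_of_all _ hdens_lt) _ hB']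
        simp only [ENNReal.toReal_ofReal (hk_nonneg _ _)]
    _ = ∫ z in B, ∫ y, k z y • φ (z, y) ∂ν ∂μ := by
        rw [setIntegral_prod _ hkφ.integrableOn, Measure.restrict_univ]

theorem ae_eq_condExp_of_map_eq_withDensity [IsFiniteMeasure P] [CompleteSpace E] [BorelSpace E]
    [SecondCountableTopology E] (hZ : Measurable Z) (hY : Measurable Y)
    (hk : Measurable (Function.uncurry k)) (hk_nonneg : ∀ z y, 0 ≤ k z y)
    (hlaw : P.map (fun s => (Z s, Y s)) =
      (μ.prod ν).withDensity fun q => ENNReal.ofReal (k q.1 q.2))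
    (hYint : Integrable Y P) {g : α → E} (hg : Measurable g)
    (hgint : Integrable (fun s => g (Z s)) P)
    (hgk : ∀ z, (∫ y, k z y ∂ν) • g z = ∫ y, k z y • y ∂ν) :
    (fun s => g (Z s)) =ᵐ[P] P[Y | MeasurableSpace.comap Z inferInstance] := by
  refine ae_eq_condExp_of_forall_setIntegral_eq hZ.comap_le hYint
    (fun _ _ _ => hgint.integrableOn) ?_
    (hg.comp (comap_measurable Z)).stronglyMeasurable.aestronglyMeasurable
  rintro _ ⟨B, hB, rfl⟩ -
  calc ∫ s in Z ⁻¹' B, g (Z s) ∂P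
      = ∫ z in B, ∫ y, k z y • g z ∂ν ∂μ :=
        setIntegral_preimage_eq_of_map_eq_withDensity hZ hY hk hk_nonneg hlaw
          (φ := fun q => g q.1) (hg.comp measurable_fst).stronglyMeasurable hgint hB
    _ = ∫ z in B, ∫ y, k z y • y ∂ν ∂μ := by simp only [integral_smul_const, hgk]
    _ = ∫ s in Z ⁻¹' B, Y s ∂P :=
        (setIntegral_preimage_eq_of_map_eq_withDensity hZ hY hk hk_nonneg hlaw
          (φ := Prod.snd) measurable_snd.stronglyMeasurable hYint hB).symm

end JointDensity

section InterpolantLaw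

theorem map_withDensity_of_measurePreserving {α β : Type*} [MeasurableSpace α] [MeasurableSpace β]
    {μ : Measure α} {ν : Measure β} {T : β → α} {R : α → β} {f : α → ENNReal}
    (hT : MeasurePreserving T ν μ) (hR : Measurable R) (hRT : Function.LeftInverse R T)
    (hf : Measurable f) : (μ.withDensity f).map R = ν.withDensity (f ∘ T) := by
  ext B hB
  rw [Measure.map_apply hR hB, withDensity_apply _ (hR hB), withDensity_apply _ hB, ← hT.map_eq,
    setLIntegral_map (hR hB) hf hT.measurable, ← preimage_comp, hRT.comp_eq_id, preimage_id]
  rfl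

theorem ae_mem_of_map_eq_withDensity {S α : Type*} [MeasurableSpace S] [MeasurableSpace α]
    {P : Measure S} {μ : Measure α} {X : S → α} {f : α → ENNReal} {s : Set α} (hX : Measurable X)
    (hf : Measurable f) (hlaw : P.map X = μ.withDensity f) (hfs : ∀ x ∉ s, f x = 0) :
    ∀ᵐ ω ∂P, X ω ∈ s := by
  refine ae_of_ae_map hX.aemeasurable ?_
  rw [hlaw, ae_withDensity_iff hf]
  exact ae_of_all _ fun x => not_imp_comm.1 (hfs x)

variable {E : Type*} [NormedAddCommGroup E] [NormedSpace ℝ E] [MeasurableSpace E] [BorelSpace E]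
  [SecondCountableTopology E] {μ : Measure E} [SFinite μ] [μ.IsAddRightInvariant]

theorem measurePreserving_endpoints (t : ℝ) :
    MeasurePreserving (fun q : E × E => (q.1 - t • q.2, q.1 + (1 - t) • q.2))
      (μ.prod μ) (μ.prod μ) := by
  have hshift : MeasurePreserving (fun q : E × E => (q.1, q.2 - t • q.1)) (μ.prod μ) (μ.prod μ) :=
    (MeasurePreserving.id μ).skew_product (g := fun δ z : E => z - t • δ)
      (Continuous.measurable (by fun_prop))
      (ae_of_all _ fun δ => (measurePreserving_sub_right μ (t • δ)).map_eq)
  convert (measurePreserving_prod_add_right μ μ).comp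
    ((Measure.measurePreserving_swap.comp hshift).comp Measure.measurePreserving_swap) using 2
    with q
  simp only [Function.comp_apply, Prod.fst_swap, Prod.snd_swap, Prod.swap_prod_mk]
  congr 1
  module

theorem map_interpolant_displacement {S : Type*} [MeasurableSpace S] {P : Measure S}
    [IsFiniteMeasure P] {X₀ X₁ : S → E} (hX₀ : Measurable X₀) (hX₁ : Measurable X₁)
    (hindep : IndepFun X₀ X₁ P) {f₀ f₁ : E → ENNReal} (hf₀ : Measurable f₀) (hf₁ : Measurable f₁)
    (hlaw₀ : P.map X₀ = μ.withDensity f₀) (hlaw₁ : P.map X₁ = μ.withDensity f₁) (t : ℝ) :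
    P.map (fun s => ((1 - t) • X₀ s + t • X₁ s, X₁ s - X₀ s)) =
      (μ.prod μ).withDensity fun q => f₀ (q.1 - t • q.2) * f₁ (q.1 + (1 - t) • q.2) := by
  have hpair : P.map (fun s => (X₀ s, X₁ s)) =
      (μ.prod μ).withDensity fun q => f₀ q.1 * f₁ q.2 := by
    rw [(indepFun_iff_map_prod_eq_prod_map_map hX₀.aemeasurable hX₁.aemeasurable).1 hindep,
      hlaw₀, hlaw₁, prod_withDensity hf₀ hf₁]
  have hR : Measurable fun q : E × E => ((1 - t) • q.1 + t • q.2, q.2 - q.1) :=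
    Continuous.measurable (by fun_prop)
  have hinv : Function.LeftInverse (fun q : E × E => ((1 - t) • q.1 + t • q.2, q.2 - q.1))
      fun q => (q.1 - t • q.2, q.1 + (1 - t) • q.2) := by
    rintro ⟨z, δ⟩
    ext1 <;> dsimp only <;> module
  have hf : Measurable fun q : E × E => f₀ q.1 * f₁ q.2 :=
    (hf₀.comp measurable_fst).mul (hf₁.comp measurable_snd)
  calc P.map (fun s => ((1 - t) • X₀ s + t • X₁ s, X₁ s - X₀ s))
      = (P.map fun s => (X₀ s, X₁ s)).map fun q => ((1 - t) • q.1 + t • q.2, q.2 - q.1) :=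
        (Measure.map_map hR (hX₀.prodMk hX₁)).symm
    _ = (μ.prod μ).withDensity fun q => f₀ (q.1 - t • q.2) * f₁ (q.1 + (1 - t) • q.2) := by
        rw [hpair]
        simpa only [Function.comp_def] using
          map_withDensity_of_measurePreserving (measurePreserving_endpoints t) hR hinv hf

end InterpolantLaw

section ConditionalExpectation

variable {d : ℕ} {Ω : Set (EuclideanSpace ℝ (Fin d))} {p₀ p₁ : EuclideanSpace ℝ (Fin d) → ℝ}
  {S : Type*} [MeasurableSpace S] {P : Measure S} [IsFiniteMeasure P]
  {X₀ X₁ : S → EuclideanSpace ℝ (Fin d)}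

theorem velocity_ae_eq_condExp (hX₀ : Measurable X₀) (hX₁ : Measurable X₁)
    (hindep : IndepFun X₀ X₁ P)
    (hlaw₀ : P.map X₀ = volume.withDensity (fun x => ENNReal.ofReal (p₀ x)))
    (hlaw₁ : P.map X₁ = volume.withDensity (fun x => ENNReal.ofReal (p₁ x)))
    (hΩ : IsCompact Ω) (h₀ : IsRegularDensityOn Ω p₀) (h₁ : IsRegularDensityOn Ω p₁) (t : ℝ) :
    (fun s => velocity p₀ p₁ t ((1 - t) • X₀ s + t • X₁ s)) =ᵐ[P]
      P[fun s => X₁ s - X₀ s |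
        MeasurableSpace.comap (fun s => (1 - t) • X₀ s + t • X₁ s) inferInstance] := by
  have hp₀ := (h₀.measurable hΩ.measurableSet).ennreal_ofReal
  have hp₁ := (h₁.measurable hΩ.measurableSet).ennreal_ofReal
  have hZ : Measurable fun s => (1 - t) • X₀ s + t • X₁ s :=
    (hX₀.const_smul (1 - t)).add (hX₁.const_smul t)
  have hv : Measurable (velocity p₀ p₁ t) :=
    (measurable_velocity hΩ.measurableSet h₀ h₁).comp measurable_prodMk_left
  have hk : Measurable (Function.uncurry (interpKernel p₀ p₁ t)) :=
    (measurable_interpKernel hΩ.measurableSet h₀ h₁).comp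
      ((measurable_const.prodMk measurable_fst).prodMk measurable_snd)
  have hlaw : P.map (fun s => ((1 - t) • X₀ s + t • X₁ s, X₁ s - X₀ s)) =
      (volume.prod volume).withDensity
        fun q => ENNReal.ofReal (interpKernel p₀ p₁ t q.1 q.2) := by
    simpa only [interpKernel, ENNReal.ofReal_mul (h₀.nonneg _)] using
      map_interpolant_displacement hX₀ hX₁ hindep hp₀ hp₁ hlaw₀ hlaw₁ t
  have hX₀Ω : ∀ᵐ s ∂P, X₀ s ∈ Ω :=
    ae_mem_of_map_eq_withDensity hX₀ hp₀ hlaw₀ fun x hx => by simp [h₀.eq_zero_off x hx]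
  have hX₁Ω : ∀ᵐ s ∂P, X₁ s ∈ Ω :=
    ae_mem_of_map_eq_withDensity hX₁ hp₁ hlaw₁ fun x hx => by simp [h₁.eq_zero_off x hx]
  have hXint : Integrable (fun s => X₁ s - X₀ s) P := by
    refine Integrable.of_bound (hX₁.sub hX₀).aestronglyMeasurable (Metric.diam Ω) ?_
    filter_upwards [hX₀Ω, hX₁Ω] with s hs₀ hs₁
    rw [← dist_eq_norm]
    exact Metric.dist_le_diam_of_mem hΩ.isBounded hs₁ hs₀
  have hvint : Integrable (fun s => velocity p₀ p₁ t ((1 - t) • X₀ s + t • X₁ s)) P :=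
    Integrable.of_bound (hv.comp hZ).aestronglyMeasurable (Metric.diam Ω)
      (ae_of_all _ fun s => norm_velocity_le hΩ h₀ h₁ t _)
  exact ae_eq_condExp_of_map_eq_withDensity hZ (hX₁.sub hX₀) hk (interpKernel_nonneg h₀ h₁ t) hlaw
    hXint hv hvint (interpDensity_smul_velocity hΩ h₀ h₁ t)

end ConditionalExpectation

section Uniqueness

variable {d : ℕ} {v : ℝ → EuclideanSpace ℝ (Fin d) → EuclideanSpace ℝ (Fin d)}
  {x x' : EuclideanSpace ℝ (Fin d)} {y z : ℝ → EuclideanSpace ℝ (Fin d)} {κ : ℝ → ℝ}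

/-- Every point of `U` has a neighbourhood on which all fields `v t`, `t ∈ [0, 1]`, admit a common
constant multiple of `κ` as modulus of continuity. This is what Osgood's uniqueness criterion asks
of a vector field. -/
def LocallyHasModulus (v : ℝ → EuclideanSpace ℝ (Fin d) → EuclideanSpace ℝ (Fin d))
    (U : Set (EuclideanSpace ℝ (Fin d))) (κ : ℝ → ℝ) : Prop :=
  ∀ x ∈ U, ∃ ρ, 0 < ρ ∧ ∃ C, 0 ≤ C ∧ ∀ t ∈ Icc (0 : ℝ) 1,
    ∀ z ∈ Metric.closedBall x ρ, ∀ z' ∈ Metric.closedBall x ρ,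
      ‖v t z - v t z'‖ ≤ C * κ ‖z - z'‖

namespace IsCaratheodorySolution

theorem continuousOn (hz : IsCaratheodorySolution v x z) : ContinuousOn z (Icc 0 1) := by
  have hint := (intervalIntegrable_iff_integrableOn_Icc_of_le zero_le_one).1 hz.intervalIntegrable
  rw [← uIcc_of_le zero_le_one] at hint ⊢
  exact (continuousOn_const.add (intervalIntegral.continuousOn_primitive_interval hint)).congr
    (uIcc_of_le (zero_le_one' ℝ) ▸ hz.integral_eq)

theorem map_zero (hz : IsCaratheodorySolution v x z) : z 0 = x := by
  simpa using hz.integral_eq 0 (left_mem_Icc.2 zero_le_one)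

theorem intervalIntegrable_of_mem (hz : IsCaratheodorySolution v x z) {s t : ℝ}
    (hs : s ∈ Icc (0 : ℝ) 1) (ht : t ∈ Icc (0 : ℝ) 1) :
    IntervalIntegrable (fun u => v u (z u)) volume s t :=
  hz.intervalIntegrable.mono_set
    (uIcc_of_le (zero_le_one' ℝ) ▸ ordConnected_Icc.uIcc_subset hs ht)

theorem sub_eq_integral (hz : IsCaratheodorySolution v x z) {s t : ℝ} (hs : s ∈ Icc (0 : ℝ) 1)
    (ht : t ∈ Icc (0 : ℝ) 1) : z t - z s = ∫ u in s..t, v u (z u) := by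
  have h0 : (0 : ℝ) ∈ Icc (0 : ℝ) 1 := left_mem_Icc.2 zero_le_one
  rw [hz.integral_eq t ht, hz.integral_eq s hs, add_sub_add_left_eq_sub,
    intervalIntegral.integral_interval_sub_left (hz.intervalIntegrable_of_mem h0 ht)
      (hz.intervalIntegrable_of_mem h0 hs)]

theorem eqOn_Icc_of_norm_sub_le (hy : IsCaratheodorySolution v x y)
    (hz : IsCaratheodorySolution v x' z) (hκ : IsOsgood κ) {a b C : ℝ}
    (hab : Icc a b ⊆ Icc 0 1) (hya : y a = z a) (hC : 0 ≤ C)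
    (hv : ∀ t ∈ Icc a b, ‖v t (y t) - v t (z t)‖ ≤ C * κ ‖y t - z t‖) : EqOn y z (Icc a b) := by
  have hcont : ContinuousOn (fun t => ‖y t - z t‖) (Icc a b) :=
    ((hy.continuousOn.mono hab).sub (hz.continuousOn.mono hab)).norm
  have hle : ∀ t ∈ Icc a b, ‖y t - z t‖ ≤ ∫ s in a..t, C * κ ‖y s - z s‖ := fun t ht => by
    have ha01 := hab (left_mem_Icc.2 (ht.1.trans ht.2))
    have hsub : Icc a t ⊆ Icc a b := Icc_subset_Icc_right ht.2
    have hdiff : y t - z t = ∫ s in a..t, (v s (y s) - v s (z s)) := by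
      rw [intervalIntegral.integral_sub (hy.intervalIntegrable_of_mem ha01 (hab ht))
        (hz.intervalIntegrable_of_mem ha01 (hab ht)), ← hy.sub_eq_integral ha01 (hab ht),
        ← hz.sub_eq_integral ha01 (hab ht), hya, sub_sub_sub_cancel_right]
    rw [hdiff]
    exact intervalIntegral.norm_integral_le_of_norm_le ht.1
      (ae_of_all _ fun s hs => hv s (hsub (Ioc_subset_Icc_self hs)))
      ((intervalIntegrable_comp_of_monotoneOn hκ.monotoneOn ht.1 (hcont.mono hsub)
        fun _ _ => norm_nonneg _).const_mul C)
  exact fun t ht => sub_eq_zero.1 <| norm_eq_zero.1 <|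
    hκ.eqOn_zero_of_le_integral hC hcont (fun _ _ => norm_nonneg _) hle ht

theorem eqOn_Icc (hy : IsCaratheodorySolution v x y) (hz : IsCaratheodorySolution v x z)
    (hκ : IsOsgood κ) {U : Set (EuclideanSpace ℝ (Fin d))} (hv : LocallyHasModulus v U κ)
    (hzU : MapsTo z (Ico 0 1) U) : EqOn y z (Icc 0 1) := by
  refine IsClosed.Icc_subset_of_forall_mem_nhdsWithin (s := {t | y t = z t}) ?_
    (hy.map_zero.trans hz.map_zero.symm) ?_
  · have := (hy.continuousOn.sub hz.continuousOn).preimage_isClosed_of_isClosed isClosed_Icc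
      (isClosed_singleton (x := 0))
    convert this using 1
    ext t
    simp [sub_eq_zero, and_comm]
  · rintro τ ⟨hτeq : y τ = z τ, hτ⟩
    obtain ⟨ρ, hρ, C, hC, hmod⟩ := hv (z τ) (hzU hτ)
    have hball : Metric.closedBall (z τ) ρ ∈ 𝓝 (z τ) := Metric.closedBall_mem_nhds _ hρ
    have h01 : Icc (0 : ℝ) 1 ∈ 𝓝[≥] τ := Icc_mem_nhdsGE_of_mem hτ
    have hyτ := (hy.continuousOn τ (Ico_subset_Icc_self hτ)).mono_of_mem_nhdsWithin h01
    rw [ContinuousWithinAt, hτeq] at hyτ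
    have hzτ := (hz.continuousOn τ (Ico_subset_Icc_self hτ)).mono_of_mem_nhdsWithin h01
    obtain ⟨b, hτb, hb⟩ := mem_nhdsGE_iff_exists_Icc_subset.1 <|
      inter_mem h01 (inter_mem (hyτ hball) (hzτ hball))
    have hle : ∀ t ∈ Icc τ b, ‖v t (y t) - v t (z t)‖ ≤ C * κ ‖y t - z t‖ := fun t ht =>
      hmod t (hb ht).1 (y t) (hb ht).2.1 (z t) (hb ht).2.2
    exact mem_of_superset (Icc_mem_nhdsGT hτb)
      (hy.eqOn_Icc_of_norm_sub_le hz hκ (fun t ht => (hb ht).1) hτeq hC hle)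

end IsCaratheodorySolution

end Uniqueness

section Flow

theorem hasDerivAt_of_eq_integral {E : Type*} [NormedAddCommGroup E] [NormedSpace ℝ E]
    [CompleteSpace E] {f z : ℝ → E} {x : E} {a b t : ℝ} (hf : ContinuousOn f (Ico a b))
    (hz : ∀ t ∈ Ioo a b, z t = x + ∫ s in a..t, f s) (ht : t ∈ Ioo a b) :
    HasDerivAt z (f t) t := by
  have hf' : ContinuousOn f (Ioo a b) := hf.mono Ioo_subset_Ico_self
  have hint : IntervalIntegrable f volume a t := ContinuousOn.intervalIntegrable_of_Icc ht.1.le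
    (hf.mono fun s hs => ⟨hs.1, hs.2.trans_lt ht.2⟩)
  refine ((intervalIntegral.integral_hasDerivAt_right hint
    (hf'.stronglyMeasurableAtFilter isOpen_Ioo t ht)
    (hf'.continuousAt (isOpen_Ioo.mem_nhds ht))).const_add x).congr_of_eventuallyEq ?_
  filter_upwards [isOpen_Ioo.mem_nhds ht] with u hu using hz u hu

variable {d : ℕ} {Ω : Set (EuclideanSpace ℝ (Fin d))} {p₀ p₁ : EuclideanSpace ℝ (Fin d) → ℝ}
  {x : EuclideanSpace ℝ (Fin d)} {z : ℝ → EuclideanSpace ℝ (Fin d)}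

theorem locallyHasModulus_velocity (hΩ : IsCompact Ω) (hconv : Convex ℝ Ω)
    (h₀ : IsRegularDensityOn Ω p₀) (h₁ : IsRegularDensityOn Ω p₁) :
    LocallyHasModulus (velocity p₀ p₁) (interior Ω) fun η => densityModulus Ω p₀ p₁ η + η := by
  intro x hx
  obtain ⟨R, hR, hball⟩ := Metric.nhds_basis_closedBall.mem_iff.1 (mem_interior_iff_mem_nhds.1 hx)
  obtain ⟨C, hC, hmod⟩ := exists_norm_velocity_sub_le hΩ hconv h₀ h₁ (half_pos hR)
  refine ⟨R / 4, by positivity, C, hC, fun t ht z hz z' hz' => ?_⟩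
  have hsub : ∀ w ∈ Metric.closedBall x (R / 4), Metric.closedBall w (R / 2) ⊆ Ω := fun w hw =>
    (Metric.closedBall_subset_closedBall' (by linarith [Metric.mem_closedBall.1 hw])).trans hball
  refine hmod t ht z z' (hsub z hz) (hsub z' hz') ?_
  rw [← dist_eq_norm]
  linarith [dist_triangle_right z z' x, Metric.mem_closedBall.1 hz, Metric.mem_closedBall.1 hz']

theorem intervalIntegrable_velocity_comp (hΩ : IsCompact Ω) (h₀ : IsRegularDensityOn Ω p₀)
    (h₁ : IsRegularDensityOn Ω p₁) (hz : Measurable z) (a b : ℝ) :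
    IntervalIntegrable (fun s => velocity p₀ p₁ s (z s)) volume a b :=
  (intervalIntegrable_const (c := Metric.diam Ω)).mono_fun
    ((measurable_velocity hΩ.measurableSet h₀ h₁).comp
      (measurable_id.prodMk hz)).aestronglyMeasurable
    (ae_of_all _ fun s => (norm_velocity_le hΩ h₀ h₁ s (z s)).trans (le_abs_self _))

theorem mem_interior_of_eq_integral_velocity (hΩ : IsCompact Ω) (hconv : Convex ℝ Ω)
    (h₀ : IsRegularDensityOn Ω p₀) (h₁ : IsRegularDensityOn Ω p₁) (hx : x ∈ interior Ω) {τ : ℝ}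
    (hτ : τ ∈ Ico (0 : ℝ) 1) (hzc : Continuous z) (hz0 : z 0 = x)
    (hz : ∀ t ∈ Ioo 0 τ, z t = x + ∫ s in (0 : ℝ)..t, velocity p₀ p₁ s (z s))
    (hin : ∀ t ∈ Ico 0 τ, z t ∈ interior Ω) : z τ ∈ interior Ω := by
  rcases hτ.1.eq_or_lt with rfl | hτ_pos
  · rwa [hz0]
  have hvc : ContinuousOn (fun s => velocity p₀ p₁ s (z s)) (Ico 0 τ) := fun s hs =>
    ((continuousAt_uncurry_velocity hΩ hconv h₀ h₁ ⟨hs.1, (hs.2.trans hτ.2).le⟩ (hin s hs)).comp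
      (f := fun s => (s, z s)) (continuousAt_id.prodMk hzc.continuousAt)).continuousWithinAt
  obtain ⟨w, hw, hzτ⟩ := exists_eq_add_smul_of_hasDerivAt hconv hΩ.isClosed hτ_pos hτ.2
    hzc.continuousOn (fun t ht => hasDerivAt_of_eq_integral hvc hz ht)
    (intervalIntegrable_velocity_comp hΩ h₀ h₁ hzc.measurable 0 τ)
    fun t ht => add_smul_velocity_mem hΩ hconv h₀ h₁ ⟨ht.1.le, (ht.2.trans hτ.2).le⟩
      (hin t (Ioo_subset_Ico_self ht))
  rw [hzτ, hz0]
  exact hconv.combo_interior_self_mem_interior hx hw (sub_pos.2 hτ.2) hτ_pos.le (by ring)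

theorem exists_isCaratheodorySolution_velocity (hΩ : IsCompact Ω) (hconv : Convex ℝ Ω)
    (h₀ : IsRegularDensityOn Ω p₀) (h₁ : IsRegularDensityOn Ω p₁) (hx : x ∈ interior Ω) :
    ∃ z, IsCaratheodorySolution (velocity p₀ p₁) x z ∧ MapsTo z (Ico 0 1) (interior Ω) ∧
      z 1 ∈ Ω := by
  obtain ⟨z, hzc, hz0, hz⟩ := exists_solution_until_exit (D := ⟨Metric.diam Ω, Metric.diam_nonneg⟩)
    (measurable_velocity hΩ.measurableSet h₀ h₁) (norm_velocity_le hΩ h₀ h₁) zero_le_one x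
    isOpen_interior fun t ht => continuousOn_velocity hΩ hconv h₀ h₁ (Ico_subset_Icc_self ht)
  have hin : MapsTo z (Ico 0 1) (interior Ω) :=
    mapsTo_Ico_of_isOpen hzc.continuousOn isOpen_interior fun τ hτ hτin =>
      mem_interior_of_eq_integral_velocity hΩ hconv h₀ h₁ hx hτ hzc hz0
        (fun t ht => hz t ⟨ht.1.le, (ht.2.trans hτ.2).le⟩ fun s hs =>
          hτin s ⟨hs.1, hs.2.trans ht.2⟩) hτin
  have hsol : IsCaratheodorySolution (velocity p₀ p₁) x z :=
    ⟨intervalIntegrable_velocity_comp hΩ h₀ h₁ hzc.measurable 0 1,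
      fun t ht => hz t ht fun s hs => hin ⟨hs.1, hs.2.trans_le ht.2⟩⟩
  refine ⟨z, hsol, hin, hΩ.isClosed.closure_subset ?_⟩
  have h1 : (1 : ℝ) ∈ closure (Ico 0 1) :=
    closure_Ico (zero_ne_one' ℝ) ▸ right_mem_Icc.2 zero_le_one
  exact hzc.continuousWithinAt.mem_closure h1 fun t ht => interior_subset (hin ht)

end Flow

end RectifiedFlow

theorem mainTheorem2 {d : ℕ} {S : Type*} [MeasurableSpace S]
    (P : Measure S) [IsProbabilityMeasure P]
    (X₀ X₁ : S → EuclideanSpace ℝ (Fin d)) (hX₀ : Measurable X₀) (hX₁ : Measurable X₁)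
    (hindep : IndepFun X₀ X₁ P)
    (p₀ p₁ : EuclideanSpace ℝ (Fin d) → ℝ)
    (hlaw₀ : P.map X₀ = volume.withDensity (fun x => ENNReal.ofReal (p₀ x)))
    (hlaw₁ : P.map X₁ = volume.withDensity (fun x => ENNReal.ofReal (p₁ x)))
    (Ω : Set (EuclideanSpace ℝ (Fin d)))
    (hcompact : IsCompact Ω) (hconvex : Convex ℝ Ω) (hint : (interior Ω).Nonempty)
    (hp₀ : RectifiedFlow.IsRegularDensityOn Ω p₀)
    (hp₁ : RectifiedFlow.IsRegularDensityOn Ω p₁)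
    (hosgood : RectifiedFlow.IsOsgood
      (fun η => RectifiedFlow.densityModulus Ω p₀ p₁ η + η)) :
    -- the velocity field is the version of the conditional expectation continuous on `interior Ω`
    (∀ t ∈ Icc (0 : ℝ) 1,
      ContinuousOn (RectifiedFlow.velocity p₀ p₁ t) (interior Ω) ∧
      (fun s => RectifiedFlow.velocity p₀ p₁ t ((1 - t) • X₀ s + t • X₁ s)) =ᵐ[P]
        P[fun s => X₁ s - X₀ s |
          MeasurableSpace.comap (fun s => (1 - t) • X₀ s + t • X₁ s) inferInstance]) ∧
    -- existence and uniqueness of the solution, which stays in the interior before time `1`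
    ∀ x ∈ interior Ω, ∃ z : ℝ → EuclideanSpace ℝ (Fin d),
      RectifiedFlow.IsCaratheodorySolution (RectifiedFlow.velocity p₀ p₁) x z ∧
      (∀ t ∈ Ico (0 : ℝ) 1, z t ∈ interior Ω) ∧ z 1 ∈ Ω ∧
      ∀ y : ℝ → EuclideanSpace ℝ (Fin d),
        RectifiedFlow.IsCaratheodorySolution (RectifiedFlow.velocity p₀ p₁) x y →
        EqOn y z (Icc 0 1) := by
  refine ⟨fun t ht => ⟨?_, ?_⟩, fun x hx => ?_⟩
  · exact RectifiedFlow.continuousOn_velocity hcompact hconvex hp₀ hp₁ ht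
  · exact RectifiedFlow.velocity_ae_eq_condExp hX₀ hX₁ hindep hlaw₀ hlaw₁ hcompact hp₀ hp₁ t
  · obtain ⟨z, hz, hin, hz1⟩ :=
      RectifiedFlow.exists_isCaratheodorySolution_velocity hcompact hconvex hp₀ hp₁ hx
    exact ⟨z, hz, hin, hz1, fun y hy => hy.eqOn_Icc hz hosgood
      (RectifiedFlow.locallyHasModulus_velocity hcompact hconvex hp₀ hp₁) hin⟩
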